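/- Let $\Bbbk$ be an algebraically closed field and let $G\subset \mathrm{SL}(n,\Bbbk)$ be a finite group of diagonal matrices whose order is not divisible by the characteristic of $\Bbbk$. Let $G^*=\mathrm{Hom}(G,\Bbbk^\times)$ and let $\rho_i\in G^*$ send $g$ to its $i$-th diagonal entry. **Algebra.** The McKay quiver $Q$ has vertex set $G^*$ and an arrow $a_i^\rho$ from $\rho\rho_i$ to $\rho$ with label $x_i$ for each $\rho\in G^*$, $1\le i\le n$. For a path $p$ let $x^{\mathrm{div}(p)}$ be the product of the labels of its arrows and $v(p)\in\mathbb{N}^{Q_1}$ the vector counting its arrows. Let $A$ be the quotient of the path algebra $\Bbbk Q$ (where $pq$ means $p$ after $q$) by the two-sided ideal generated by all $p^+-p^-$ with $p^\pm$ paths having the same head, tail and divisor. Let $W$ be the sum of all cycles $p$ with $x^{\mathrm{div}(p)}=x_1\cdots x_n$; for a path $q$, let $\partial_qW$ be the sum of all paths $p$ from the head to the tail of $q$ with $x^{\mathrm{div}(p)}x^{\mathrm{div}(q)}=x_1\cdots x_n$. Let $\Lambda$ be the quotient of $\mathbb{Z}^{Q_1}$ by all $v(p^+)-v(p^-)$ for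 which $\partial_qW=p^++p^-$ for some $q$, the sum having precisely two terms that share neither initial nor final arrow, and let $\Lambda_+$ be the image of $\mathbb{N}^{Q_1}$ in $\Lambda$. Paths have degree in $\Lambda_+$ given by the class of $v(p)$. **Cells.** Let $M$ be the kernel of $\mathbb{Z}^n\to G^*$, $u\mapsto\prod_i\rho_i^{u_i}$. The covering quiver has vertex set $\mathbb{Z}^n$ and an arrow $u\to u+\chi_i$ for all $u,i$, where $\chi_i$ is the $i$-th standard basis vector; it maps to $Q$ by sending $u$ to $(\prod_i\rho_i^{u_i})^{-1}$ and preserving labels. The toric cell complex $\Delta$ is the set of images in $\mathbb{R}^n/M$ of the faces of the unit cubes $u+[0,1]^n$, $u\in\mathbb{Z}^n$ (together with $\emptyset$, of dimension $-1$); equivalently, its cells are the $M$-orbits of such faces. Write $\Delta_k$ for the set of $k$-cells. A lift of a cell is a face $F$ of a unit cube mapping to it. The head and tail of $F$ are its vertices with the largest and smallest coordinate sum; their images in $G^*$ are the head $\mathsf{h}(\eta)$ and tail $\mathsf{t}(\eta)$ of the cell $\eta$. The degree of $\eta$ is that of the image in $Q$ of a path in the covering quiver from the tail to the head of $F$. For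 a face $F'$ of $F$, the left derivative $\overleftarrow{\partial}_{F'}F\in A$ is the class of the image of a path from the head of $F'$ to the head of $F$, and the right derivative $\overrightarrow{\partial}_{F'}F\in A$ is that of a path from the tail of $F$ to the tail of $F'$. An *incidence function* $\varepsilon$ on $\Delta$ assigns to every pair $(F,F')$ of faces (possibly empty) of unit cubes a value $\varepsilon(F,F')\in\{0,\pm1\}$ such that: $\varepsilon(F+m,F'+m)=\varepsilon(F,F')$ for $m\in M$; $\varepsilon(F,F')\ne0$ if and only if $F'$ is a facet (codimension-one face) of $F$; $\varepsilon(F,\emptyset)=1$ for vertices $F$; and if $F''$ is a codimension-two face of $F$ and $F'_1,F'_2$ are the two facets of $F$ containing $F''$, then $\varepsilon(F,F_1')\varepsilon(F_1',F'')+\varepsilon(F,F_2')\varepsilon(F_2',F'')=0$. **The complex.** Let $e_v\in A$ be the idempotent of the vertex $v$ and put $P_k=\bigoplus_{\eta\in\Delta_k}Ae_{\mathsf{h}(\eta)}\otimes[\eta]\otimes e_{\mathsf{t}(\eta)}A$ (tensor products over $\Bbbk$), where the elements $a\otimes[\eta]\otimes b$ with $a$, $b$ homogeneous have degree $\deg a+\deg\eta+\deg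 b$. Let $\mu\colon P_0\to A$ be the multiplication map. For an incidence function $\varepsilon$, let $d_k\colon P_k\to P_{k-1}$ be the $(A,A)$-bimodule map with $$d_k(1\otimes[\eta]\otimes1)=\sum_{F'}\varepsilon(F,F')\,\overleftarrow{\partial}_{F'}F\otimes[\eta_{F'}]\otimes\overrightarrow{\partial}_{F'}F,$$ where $F$ is a lift of $\eta$, the sum is over the facets $F'$ of $F$, and $\eta_{F'}$ is the cell that is the image of $F'$. **Proposition.** $A$ is a $\Lambda_+$-graded algebra, every $P_k$ is a $\Lambda_+$-graded $(A,A)$-bimodule, $P_k=0$ for $k>n$, and for every incidence function $\varepsilon$ the sequence $$0\to P_n\xrightarrow{d_n}\cdots\xrightarrow{d_2}P_1\xrightarrow{d_1}P_0\xrightarrow{\mu}A\to0$$ is a complex of $\Lambda_+$-graded $(A,A)$-bimodules: all its maps preserve degrees and consecutive maps compose to zero. Moreover, the complexes of different incidence functions are naturally isomorphic: for all incidence functions $\varepsilon,\varepsilon'$ there is an isomorphism $\Phi_{\varepsilon,\varepsilon'}$ of complexes of $\Lambda_+$-graded $(A,A)$-bimodules from the complex of $\varepsilon$ to that of $\varepsilon'$,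 which is the identity on $A$ and multiplies every generator $1\otimes[\eta]\otimes1$ by a sign, and these satisfy $\Phi_{\varepsilon,\varepsilon}=\mathrm{id}$ and $\Phi_{\varepsilon',\varepsilon''}\circ\Phi_{\varepsilon,\varepsilon'}=\Phi_{\varepsilon,\varepsilon''}$. -/

import Mathlib

open scoped TensorProduct DirectSum
open scoped Classical
open MulOpposite

noncomputable section

/-! ## Path algebras of finite quivers -/

namespace QuiverAlg

/-- A path in a quiver, with its tail (source) and head (target). -/
structure QPath (V : Type*) [Quiver V] where
  tail : V
  head : V
  path : Quiver.Path tail head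

/-- The path algebra: its underlying vector space has the paths as a basis. -/
def PathAlgebra (k : Type*) [Field k] (V : Type*) [Quiver V] : Type _ := QPath V →₀ k

variable (k : Type*) [Field k] (V : Type*) [Quiver V]

instance : AddCommGroup (PathAlgebra k V) := inferInstanceAs (AddCommGroup (QPath V →₀ k))
instance : Module k (PathAlgebra k V) := inferInstanceAs (Module k (QPath V →₀ k))

/-- The basis element of the path algebra given by a path. -/
def PathAlgebra.ofPath (p : QPath V) : PathAlgebra k V := Finsupp.single p 1

/-- The product `p q` of two paths, which is the concatenation `p` after `q` if the head of `q`
is the tail of `p`, and zero otherwise. -/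
def PathAlgebra.pathMul (p q : QPath V) : PathAlgebra k V :=
  if h : q.head = p.tail then
    PathAlgebra.ofPath k V ⟨q.tail, p.head, (h ▸ q.path : Quiver.Path q.tail p.tail).comp p.path⟩
  else 0

/-- The linear map on the path algebra with prescribed values on paths. -/
def PathAlgebra.lift {M : Type*} [AddCommGroup M] [Module k M] (f : QPath V → M) :
    PathAlgebra k V →ₗ[k] M :=
  (Finsupp.linearCombination k f : (QPath V →₀ k) →ₗ[k] M)

theorem PathAlgebra.lift_ofPath {M : Type*} [AddCommGroup M] [Module k M] (f : QPath V → M)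
    (p : QPath V) : PathAlgebra.lift k V f (PathAlgebra.ofPath k V p) = f p :=
  (Finsupp.linearCombination_single k (1 : k) p).trans (one_smul k (f p))

/-- The bilinear extension of the product of paths. -/
def PathAlgebra.mulMap : PathAlgebra k V →ₗ[k] PathAlgebra k V →ₗ[k] PathAlgebra k V :=
  PathAlgebra.lift k V fun p => PathAlgebra.lift k V fun q => PathAlgebra.pathMul k V p q

instance : Mul (PathAlgebra k V) := ⟨fun x y => PathAlgebra.mulMap k V x y⟩

variable {k V}

theorem PathAlgebra.mul_def (x y : PathAlgebra k V) : x * y = PathAlgebra.mulMap k V x y := rfl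

theorem PathAlgebra.ofPath_mul (p q : QPath V) :
    PathAlgebra.ofPath k V p * PathAlgebra.ofPath k V q = PathAlgebra.pathMul k V p q := by
  rw [PathAlgebra.mul_def, PathAlgebra.mulMap, PathAlgebra.lift_ofPath, PathAlgebra.lift_ofPath]

theorem PathAlgebra.ofPath_mul_of_eq {a b c : V} (p : Quiver.Path b c) (q : Quiver.Path a b) :
    PathAlgebra.ofPath k V ⟨b, c, p⟩ * PathAlgebra.ofPath k V ⟨a, b, q⟩
      = PathAlgebra.ofPath k V ⟨a, c, q.comp p⟩ := by
  rw [PathAlgebra.ofPath_mul]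
  simp [PathAlgebra.pathMul]

theorem PathAlgebra.ofPath_mul_of_ne {p q : QPath V} (h : q.head ≠ p.tail) :
    PathAlgebra.ofPath k V p * PathAlgebra.ofPath k V q = 0 := by
  rw [PathAlgebra.ofPath_mul]
  simp [PathAlgebra.pathMul, h]

theorem PathAlgebra.mulMap_zero (x : PathAlgebra k V) : x * 0 = 0 := by
  rw [PathAlgebra.mul_def, map_zero]

theorem PathAlgebra.zero_mulMap (x : PathAlgebra k V) : 0 * x = 0 := by
  rw [PathAlgebra.mul_def, map_zero, LinearMap.zero_apply]

theorem PathAlgebra.induction {P : PathAlgebra k V → Prop} (x : PathAlgebra k V)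
    (h0 : P 0) (hadd : ∀ x y, P x → P y → P (x + y))
    (hs : ∀ (c : k) (p : QPath V), P (c • PathAlgebra.ofPath k V p)) : P x := by
  refine Finsupp.induction_linear (motive := P) x h0 hadd ?_
  intro p c
  have := hs c p
  have e : (c • PathAlgebra.ofPath k V p) = (Finsupp.single p c : QPath V →₀ k) := by
    unfold PathAlgebra.ofPath
    exact (Finsupp.smul_single _ _ _).trans (by simp)
  rw [e] at this
  exact this

theorem PathAlgebra.mul_assoc' (x y z : PathAlgebra k V) : x * y * z = x * (y * z) := by
  induction x using PathAlgebra.induction with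
  | h0 => simp only [PathAlgebra.zero_mulMap]
  | hadd x x' hx hx' =>
    simp only [PathAlgebra.mul_def, map_add, LinearMap.add_apply] at *
    rw [hx, hx']
  | hs c p =>
  induction y using PathAlgebra.induction with
  | h0 => simp only [PathAlgebra.zero_mulMap, PathAlgebra.mulMap_zero]
  | hadd x x' hx hx' =>
    simp only [PathAlgebra.mul_def, map_add, LinearMap.add_apply] at *
    rw [hx, hx']
  | hs d q =>
  induction z using PathAlgebra.induction with
  | h0 => simp only [PathAlgebra.mulMap_zero]
  | hadd x x' hx hx' =>
    simp only [PathAlgebra.mul_def, map_add] at *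
    rw [hx, hx']
  | hs e r =>
  have key : PathAlgebra.ofPath k V p * PathAlgebra.ofPath k V q * PathAlgebra.ofPath k V r
      = PathAlgebra.ofPath k V p * (PathAlgebra.ofPath k V q * PathAlgebra.ofPath k V r) := by
    obtain ⟨pt, ph, p⟩ := p
    obtain ⟨qt, qh, q⟩ := q
    obtain ⟨rt, rh, r⟩ := r
    by_cases h1 : qh = pt
    · subst h1
      by_cases h2 : rh = qt
      · subst h2
        simp only [PathAlgebra.ofPath_mul_of_eq, Quiver.Path.comp_assoc]
      · rw [PathAlgebra.ofPath_mul_of_eq, PathAlgebra.ofPath_mul_of_ne h2,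
          PathAlgebra.ofPath_mul_of_ne h2, PathAlgebra.mulMap_zero]
    · rw [PathAlgebra.ofPath_mul_of_ne h1, PathAlgebra.zero_mulMap]
      by_cases h2 : rh = qt
      · subst h2
        rw [PathAlgebra.ofPath_mul_of_eq, PathAlgebra.ofPath_mul_of_ne h1]
      · rw [PathAlgebra.ofPath_mul_of_ne h2, PathAlgebra.mulMap_zero]
  simp only [PathAlgebra.mul_def, map_smul, LinearMap.smul_apply] at *
  rw [key]

variable [Finite V]

variable (k) in
/-- The trivial path at a vertex, as an element of the path algebra. -/
def PathAlgebra.idem {V : Type*} [Quiver V] (v : V) : PathAlgebra k V :=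
  PathAlgebra.ofPath k V ⟨v, v, Quiver.Path.nil⟩

/-- The unit of the path algebra of a quiver with finitely many vertices is the sum of the
trivial paths. -/
instance : One (PathAlgebra k V) :=
  ⟨letI := Fintype.ofFinite V; ∑ v : V, PathAlgebra.idem k v⟩

theorem PathAlgebra.one_def :
    (1 : PathAlgebra k V) = letI := Fintype.ofFinite V; ∑ v : V, PathAlgebra.idem k v := rfl

theorem PathAlgebra.one_mul' (x : PathAlgebra k V) : 1 * x = x := by
  let _ := Fintype.ofFinite V
  induction x using PathAlgebra.induction with
  | h0 => rw [PathAlgebra.mulMap_zero]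
  | hadd x x' hx hx' =>
    simp only [PathAlgebra.mul_def, map_add] at *
    rw [hx, hx']
  | hs c p =>
  have key : 1 * PathAlgebra.ofPath k V p = PathAlgebra.ofPath k V p := by
    obtain ⟨a, b, p⟩ := p
    rw [PathAlgebra.one_def, PathAlgebra.mul_def, map_sum, LinearMap.sum_apply,
      Finset.sum_eq_single b]
    · rw [← PathAlgebra.mul_def, PathAlgebra.idem, PathAlgebra.ofPath_mul_of_eq,
        Quiver.Path.comp_nil]
    · intro v _ hv
      rw [← PathAlgebra.mul_def, PathAlgebra.idem, PathAlgebra.ofPath_mul_of_ne (Ne.symm hv)]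
    · intro h
      exact absurd (Finset.mem_univ b) h
  rw [PathAlgebra.mul_def] at *
  rw [map_smul, key]

theorem PathAlgebra.mul_one' (x : PathAlgebra k V) : x * 1 = x := by
  let _ := Fintype.ofFinite V
  induction x using PathAlgebra.induction with
  | h0 => rw [PathAlgebra.zero_mulMap]
  | hadd x x' hx hx' =>
    simp only [PathAlgebra.mul_def, map_add, LinearMap.add_apply] at *
    rw [hx, hx']
  | hs c p =>
  have key : PathAlgebra.ofPath k V p * 1 = PathAlgebra.ofPath k V p := by
    obtain ⟨a, b, p⟩ := p
    rw [PathAlgebra.one_def, PathAlgebra.mul_def, map_sum, Finset.sum_eq_single a]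
    · rw [← PathAlgebra.mul_def, PathAlgebra.idem, PathAlgebra.ofPath_mul_of_eq,
        Quiver.Path.nil_comp]
    · intro v _ hv
      rw [← PathAlgebra.mul_def, PathAlgebra.idem, PathAlgebra.ofPath_mul_of_ne hv]
    · intro h
      exact absurd (Finset.mem_univ a) h
  rw [PathAlgebra.mul_def] at *
  rw [map_smul, LinearMap.smul_apply, key]

instance : Ring (PathAlgebra k V) :=
  { (inferInstance : AddCommGroup (PathAlgebra k V)),
    (inferInstance : Mul (PathAlgebra k V)),
    (inferInstance : One (PathAlgebra k V)) with
    left_distrib := fun x y z => by simp only [PathAlgebra.mul_def, map_add]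
    right_distrib := fun x y z => by
      simp only [PathAlgebra.mul_def, map_add, LinearMap.add_apply]
    zero_mul := PathAlgebra.zero_mulMap
    mul_zero := PathAlgebra.mulMap_zero
    mul_assoc := PathAlgebra.mul_assoc'
    one_mul := PathAlgebra.one_mul'
    mul_one := PathAlgebra.mul_one' }

instance : Algebra k (PathAlgebra k V) :=
  Algebra.ofModule
    (fun c x y => by
      change PathAlgebra.mulMap k V (c • x) y = c • PathAlgebra.mulMap k V x y
      rw [map_smul, LinearMap.smul_apply])
    (fun c x y => by
      change PathAlgebra.mulMap k V x (c • y) = c • PathAlgebra.mulMap k V x y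
      rw [map_smul])

end QuiverAlg

namespace McKay

open QuiverAlg

variable {n : ℕ} {X : Type*} [CommGroup X]

/-! ## The characters of a diagonal group -/

/-- The character of a group of diagonal matrices given by the `i`-th diagonal entry. -/
def diagChar {k : Type*} [Field k] (G : Subgroup (Matrix.SpecialLinearGroup (Fin n) k))
    (hG : ∀ g ∈ G, (g : Matrix (Fin n) (Fin n) k).IsDiag) (i : Fin n) : G →* kˣ :=
  MonoidHom.toHomUnits
    { toFun := fun g => (g : Matrix (Fin n) (Fin n) k) i i
      map_one' := by simp
      map_mul' := by
        intro g h
        rw [Subgroup.coe_mul, Matrix.SpecialLinearGroup.coe_mul, Matrix.mul_apply]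
        refine Finset.sum_eq_single i ?_ ?_
        · intro j _ hj
          rw [hG g.1 g.2 (Ne.symm hj), zero_mul]
        · intro h
          exact absurd (Finset.mem_univ i) h }

/-! ## The McKay quiver and its toric algebra -/

/-- The vertex set of the McKay quiver of the elements `ρ 0, …, ρ (n-1)` of a (character) group. -/
def Vertex (_ρ : Fin n → X) : Type _ := X

/-- The group element that is a vertex of the McKay quiver. -/
def Vertex.val {ρ : Fin n → X} (v : Vertex ρ) : X := v

/-- The McKay quiver: there is one arrow, labelled `i`, from `τ * ρ i` to `τ`, for all
`τ` and `i`. -/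
instance (ρ : Fin n → X) : Quiver (Vertex ρ) where
  Hom σ τ := {i : Fin n // σ.val = τ.val * ρ i}

instance (ρ : Fin n → X) [Finite X] : Finite (Vertex ρ) := inferInstanceAs (Finite X)

variable {ρ : Fin n → X}

/-- The divisor of a path: the exponent of the product of the labels `x_i` of its arrows. -/
def pathDiv {σ : Vertex ρ} : {τ : Vertex ρ} → Quiver.Path σ τ → Fin n → ℕ
  | _, Quiver.Path.nil => 0
  | _, Quiver.Path.cons p a => pathDiv p + Pi.single a.1 1

/-! ## The superpotential and the semigroup `Λ₊` -/

/-- A cycle is anticanonical if its label is the product of all the variables `x_i`. -/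
def IsAnticanonical {σ : Vertex ρ} (p : Quiver.Path σ σ) : Prop := pathDiv p = fun _ => 1

/-- The terms of the derivative of the superpotential (the sum of all anticanonical cycles) with
respect to a path `q`: all paths `p` from the head to the tail of `q` that complete `q` to an
anticanonical cycle. -/
def derivTerms {σ τ : Vertex ρ} (q : Quiver.Path σ τ) : Set (Quiver.Path τ σ) :=
  {p | IsAnticanonical (q.comp p)}

/-- Two paths share their initial arrow. -/
def ShareInitial {σ τ : Vertex ρ} (p q : Quiver.Path σ τ) : Prop :=
  ∃ (υ : Vertex ρ) (a : σ ⟶ υ) (p' q' : Quiver.Path υ τ),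
    p = a.toPath.comp p' ∧ q = a.toPath.comp q'

/-- Two paths share their final arrow. -/
def ShareFinal {σ τ : Vertex ρ} (p q : Quiver.Path σ τ) : Prop :=
  ∃ (υ : Vertex ρ) (a : υ ⟶ τ) (p' q' : Quiver.Path σ υ), p = p'.cons a ∧ q = q'.cons a

variable (ρ) in
/-- The set of all arrows of the McKay quiver. -/
def Arrow : Type _ := Σ σ τ : Vertex ρ, (σ ⟶ τ)

/-- The vector in `ℕ^{Q₁}` that counts how often a path traverses each arrow. -/
def pathVec {σ : Vertex ρ} : {τ : Vertex ρ} → Quiver.Path σ τ → Arrow ρ →₀ ℕ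
  | _, Quiver.Path.nil => 0
  | _, Quiver.Path.cons p a => pathVec p + Finsupp.single ⟨_, _, a⟩ 1

variable (ρ) in
/-- The inclusion of `ℕ^{Q₁}` in `ℤ^{Q₁}`. -/
def natToInt : (Arrow ρ →₀ ℕ) →+ (Arrow ρ →₀ ℤ) :=
  Finsupp.mapRange.addMonoidHom (Nat.castAddMonoidHom ℤ)

variable (ρ) in
/-- The vectors `v(p₁) - v(p₂)` for which some derivative of the superpotential is the sum of
precisely two paths `p₁` and `p₂` that share neither their initial nor their final arrow. -/
def superpotentialVectors : Set (Arrow ρ →₀ ℤ) :=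
  {w | ∃ (σ τ : Vertex ρ) (q : Quiver.Path σ τ) (p₁ p₂ : Quiver.Path τ σ),
    p₁ ≠ p₂ ∧ derivTerms q = {p₁, p₂} ∧ ¬ ShareInitial p₁ p₂ ∧ ¬ ShareFinal p₁ p₂ ∧
      w = natToInt ρ (pathVec p₁) - natToInt ρ (pathVec p₂)}

variable (ρ) in
/-- The group `Λ`. -/
abbrev Lam : Type _ := (Arrow ρ →₀ ℤ) ⧸ AddSubgroup.closure (superpotentialVectors ρ)

variable (ρ) in
/-- The restriction to `ℕ^{Q₁}` of the quotient map `wt : ℤ^{Q₁} → Λ`. -/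
def wtNat : (Arrow ρ →₀ ℕ) →+ Lam ρ :=
  (QuotientAddGroup.mk' (AddSubgroup.closure (superpotentialVectors ρ))).comp (natToInt ρ)

variable (ρ) in
/-- The semigroup `Λ₊`, the image of `ℕ^{Q₁}` in `Λ`. -/
abbrev LamPlus : AddSubmonoid (Lam ρ) := AddMonoidHom.mrange (wtNat ρ)

/-- The degree of a path in `Λ₊`. -/
def pathDeg {σ τ : Vertex ρ} (p : Quiver.Path σ τ) : LamPlus ρ := ⟨wtNat ρ (pathVec p), _, rfl⟩

/-! ## Faces of unit cubes and the toric cell complex -/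

variable (n) in
/-- A nonempty face of a unit cube in `ℝⁿ` with integral vertices, given by its smallest vertex
`base` and by the coordinate directions along which it extends. -/
@[ext]
structure CubeFace where
  base : Fin n → ℤ
  dirs : Finset (Fin n)

namespace CubeFace

/-- The face as a subset of `ℝⁿ`. -/
def carrier (F : CubeFace n) : Set (Fin n → ℝ) :=
  {x | ∀ i, (F.base i : ℝ) ≤ x i ∧ x i ≤ F.base i + if i ∈ F.dirs then 1 else 0}

/-- The vertex of the face with minimal coordinate sum. -/
def tail (F : CubeFace n) : Fin n → ℤ := F.base

/-- The vertex of the face with maximal coordinate sum. -/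
def head (F : CubeFace n) : Fin n → ℤ := fun i => F.base i + if i ∈ F.dirs then 1 else 0

/-- Translation of faces by integral vectors. -/
instance : AddAction (Fin n → ℤ) (CubeFace n) where
  vadd m F := ⟨m + F.base, F.dirs⟩
  zero_vadd F := CubeFace.ext (zero_add F.base) rfl
  add_vadd a b F := CubeFace.ext (add_assoc a b F.base) rfl

/-- The codimension-one faces of a face; see `mem_facets`. -/
def facets (F : CubeFace n) : Finset (CubeFace n) :=
  F.dirs.image (fun i => ⟨F.base, F.dirs.erase i⟩) ∪
    F.dirs.image (fun i => ⟨F.base + Pi.single i 1, F.dirs.erase i⟩)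

end CubeFace

variable (n) in
/-- The faces of unit cubes including the empty face, which is `none`. -/
abbrev Face : Type := Option (CubeFace n)

/-- A possibly empty face as a subset of `ℝⁿ`. -/
def Face.carrier : Face n → Set (Fin n → ℝ)
  | none => ∅
  | some F => F.carrier

/-- The dimension of a face; the empty face has dimension `-1`. -/
def Face.dim : Face n → ℤ
  | none => -1
  | some F => F.dirs.card

/-- `F'` is a face of `F`. -/
def Face.IsFaceOf (F' F : Face n) : Prop := F'.carrier ⊆ F.carrier

/-- `F'` is a facet of `F`, that is, a face of codimension one. -/
def Face.IsFacetOf (F' F : Face n) : Prop := F'.IsFaceOf F ∧ F'.dim + 1 = F.dim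

/-- Translation of a possibly empty face. -/
def Face.translate (m : Fin n → ℤ) (F : Face n) : Face n := F.map (m +ᵥ ·)

theorem CubeFace.mem_facets_iff (F' F : CubeFace n) :
    F' ∈ F.facets ↔ ∃ i ∈ F.dirs, F'.dirs = F.dirs.erase i ∧
      (F'.base = F.base ∨ F'.base = F.base + Pi.single i 1) := by
  simp only [CubeFace.facets, Finset.mem_union, Finset.mem_image, CubeFace.ext_iff]
  constructor
  · rintro (⟨i, hi, h1, h2⟩ | ⟨i, hi, h1, h2⟩)
    · exact ⟨i, hi, h2.symm, Or.inl h1.symm⟩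
    · exact ⟨i, hi, h2.symm, Or.inr h1.symm⟩
  · rintro ⟨i, hi, h2, h1 | h1⟩
    · exact Or.inl ⟨i, hi, h1.symm, h2.symm⟩
    · exact Or.inr ⟨i, hi, h1.symm, h2.symm⟩

theorem CubeFace.base_mem_carrier (F : CubeFace n) : (fun i => (F.base i : ℝ)) ∈ F.carrier := by
  intro i
  refine ⟨le_refl _, ?_⟩
  split_ifs <;> simp

theorem CubeFace.head_mem_carrier (F : CubeFace n) : (fun i => (F.head i : ℝ)) ∈ F.carrier := by
  intro i
  simp only [CubeFace.head]
  split_ifs <;> simp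

theorem CubeFace.carrier_subset_iff (F' F : CubeFace n) :
    F'.carrier ⊆ F.carrier ↔ F.base ≤ F'.base ∧ F'.head ≤ F.head := by
  constructor
  · intro h
    refine ⟨fun i => ?_, fun i => ?_⟩
    · exact_mod_cast (h F'.base_mem_carrier i).1
    · have := (h F'.head_mem_carrier i).2
      simp only [CubeFace.head] at this ⊢
      split_ifs at this ⊢ <;> exact_mod_cast this
  · rintro ⟨h1, h2⟩ x hx i
    have a1 : (F.base i : ℝ) ≤ F'.base i := by exact_mod_cast h1 i
    have a2 : ((F'.head i : ℤ) : ℝ) ≤ F.head i := by exact_mod_cast h2 i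
    obtain ⟨b1, b2⟩ := hx i
    simp only [CubeFace.head] at a2
    push_cast at a2
    exact ⟨a1.trans b1, b2.trans a2⟩

theorem CubeFace.mem_facets (F' F : CubeFace n) :
    F' ∈ F.facets ↔ Face.IsFacetOf (some F') (some F) := by
  rw [CubeFace.mem_facets_iff, Face.IsFacetOf, Face.IsFaceOf]
  simp only [Face.carrier, Face.dim]
  rw [CubeFace.carrier_subset_iff]
  constructor
  · rintro ⟨i, hi, hd, hb⟩
    refine ⟨⟨fun j => ?_, fun j => ?_⟩, ?_⟩
    · rcases hb with hb | hb <;> rw [hb]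
      by_cases h : j = i
      · subst h; simp
      · simp [h]
    · simp only [CubeFace.head, hd, Finset.mem_erase]
      by_cases h : j = i
      · subst h
        rcases hb with hb | hb <;> simp [hb, hi]
      · rcases hb with hb | hb <;> simp [hb, h]
    · rw [hd]
      have := Finset.card_erase_add_one hi
      exact_mod_cast this
  · rintro ⟨⟨h1, h2⟩, h3⟩
    have h3 : F'.dirs.card + 1 = F.dirs.card := by exact_mod_cast h3
    have key : ∀ j, F.base j ≤ F'.base j ∧
        (F'.base j + if j ∈ F'.dirs then 1 else 0) ≤ F.base j + if j ∈ F.dirs then 1 else 0 :=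
      fun j => ⟨h1 j, h2 j⟩
    have hsub : F'.dirs ⊆ F.dirs := by
      intro j hj
      by_contra hj'
      have := key j
      simp only [hj, hj', if_true, if_false] at this
      omega
    obtain ⟨i, hi, hd⟩ : ∃ i ∈ F.dirs, F'.dirs = F.dirs.erase i := by
      have hc : (F.dirs \ F'.dirs).card = 1 := by
        rw [Finset.card_sdiff_of_subset hsub]; omega
      obtain ⟨i, hi⟩ := Finset.card_eq_one.mp hc
      have hi' : i ∈ F.dirs \ F'.dirs := by rw [hi]; simp
      refine ⟨i, (Finset.mem_sdiff.mp hi').1, ?_⟩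
      rw [Finset.erase_eq, ← hi, Finset.sdiff_sdiff_eq_self hsub]
    refine ⟨i, hi, hd, ?_⟩
    have off : ∀ j, j ≠ i → F'.base j = F.base j := by
      intro j hj
      have := key j
      simp only [hd, Finset.mem_erase, ne_eq, hj, not_false_eq_true, true_and] at this
      omega
    have on := key i
    simp only [hd, Finset.mem_erase, ne_eq, not_true_eq_false, false_and, hi, if_true,
      if_false] at on
    have : F'.base i = F.base i ∨ F'.base i = F.base i + 1 := by omega
    rcases this with h | h
    · left
      funext j
      by_cases hj : j = i
      · rw [hj, h]
      · exact off j hj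
    · right
      funext j
      by_cases hj : j = i
      · rw [hj, h]; simp
      · rw [off j hj]; simp [hj]

variable (ρ) in
/-- The homomorphism `ℤⁿ → X` that sends the `i`-th basis vector to `ρ i`. -/
def deg : (Fin n → ℤ) →+ Additive X where
  toFun u := Additive.ofMul (∏ i, ρ i ^ u i)
  map_zero' := by simp
  map_add' u v := by
    simp [zpow_add, Finset.prod_mul_distrib]

variable (ρ) in
/-- The lattice `M`, the kernel of `deg`. -/
def lattice : AddSubgroup (Fin n → ℤ) := (deg ρ).ker

variable (ρ) in
/-- The nonempty cells of the toric cell complex. A cell is an orbit of faces of unit cubes under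
translation by `M`, that is, the image of such a face in the torus `ℝⁿ / M`;
see `image_carrier_eq_iff`. -/
abbrev Cell : Type := AddAction.orbitRel.Quotient (lattice ρ) (CubeFace n)

variable (ρ) in
/-- The real torus `ℝⁿ / M`. -/
abbrev Torus : Type :=
  (Fin n → ℝ) ⧸ (lattice ρ).map ((Int.castAddHom ℝ).compLeft (Fin n))

/-- The image of a face in the torus. -/
def torusImage (F : CubeFace n) : Set (Torus ρ) :=
  (QuotientAddGroup.mk : (Fin n → ℝ) → Torus ρ) '' F.carrier

variable (ρ) in
/-- The cell that is the image of a face. -/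
def toCell (F : CubeFace n) : Cell ρ := Quotient.mk _ F

theorem CubeFace.base_of_translate {F F' : CubeFace n} (m : Fin n → ℤ)
    (h : ∀ i, (F'.base i : ℝ) ≤ F.base i + (if i ∈ F.dirs then 1 / 2 else 0) + m i ∧
      F.base i + (if i ∈ F.dirs then 1 / 2 else 0) + m i
        ≤ (F'.base i : ℝ) + if i ∈ F'.dirs then 1 else 0) :
    F.dirs ⊆ F'.dirs ∧ (F'.dirs ⊆ F.dirs → F' = m +ᵥ F) := by
  have key : ∀ i, (i ∈ F.dirs → i ∈ F'.dirs) ∧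
      ((i ∈ F'.dirs → i ∈ F.dirs) → F'.base i = m i + F.base i) := by
    intro i
    obtain ⟨h1, h2⟩ := h i
    by_cases hi : i ∈ F.dirs <;> by_cases hi' : i ∈ F'.dirs <;>
      simp only [hi, hi', if_true, if_false] at h1 h2
    · refine ⟨fun _ => hi', fun _ => ?_⟩
      have a1 : (F'.base i : ℝ) < ((F.base i + m i + 1 : ℤ) : ℝ) := by push_cast; linarith
      have a2 : ((F.base i + m i : ℤ) : ℝ) < ((F'.base i + 1 : ℤ) : ℝ) := by push_cast; linarith
      have a1 : F'.base i < F.base i + m i + 1 := by exact_mod_cast a1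
      have a2 : F.base i + m i < F'.base i + 1 := by exact_mod_cast a2
      omega
    · exfalso
      have a1 : (F'.base i : ℝ) < ((F.base i + m i + 1 : ℤ) : ℝ) := by push_cast; linarith
      have a2 : ((F.base i + m i : ℤ) : ℝ) < ((F'.base i : ℤ) : ℝ) := by push_cast; linarith
      have a1 : F'.base i < F.base i + m i + 1 := by exact_mod_cast a1
      have a2 : F.base i + m i < F'.base i := by exact_mod_cast a2
      omega
    · exact ⟨fun h => absurd h hi, fun h => absurd (h hi') hi⟩
    · refine ⟨fun h => absurd h hi, fun _ => ?_⟩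
      have a : (F'.base i : ℝ) = ((m i + F.base i : ℤ) : ℝ) := by push_cast; linarith
      exact_mod_cast a
  exact ⟨fun i hi => (key i).1 hi, fun hs => CubeFace.ext (funext fun i => (key i).2 (@hs i))
    (Finset.Subset.antisymm hs fun i hi => (key i).1 hi)⟩

/-- Two faces have the same image in the torus if and only if they define the same cell. -/
theorem image_carrier_eq_iff (F F' : CubeFace n) :
    (torusImage F : Set (Torus ρ)) = torusImage F' ↔ toCell ρ F = toCell ρ F' := by
  have mid : ∀ F F' : CubeFace n, (torusImage F : Set (Torus ρ)) ⊆ torusImage F' →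
      ∃ m ∈ lattice ρ, F.dirs ⊆ F'.dirs ∧ (F'.dirs ⊆ F.dirs → F' = m +ᵥ F) := by
    intro F F' h
    have hx : (fun i => (F.base i : ℝ) + if i ∈ F.dirs then 1 / 2 else 0) ∈ F.carrier := by
      intro i
      constructor <;> dsimp only <;> split_ifs <;> norm_num
    obtain ⟨y, hy, hxy⟩ := h ⟨_, hx, rfl⟩
    obtain ⟨m, hm, hm'⟩ := QuotientAddGroup.eq.mp hxy.symm
    refine ⟨m, hm, CubeFace.base_of_translate m fun i => ?_⟩
    have hi := congrFun hm' i
    have hyi := hy i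
    simp only [AddMonoidHom.compLeft_apply, Function.comp_apply, Int.coe_castAddHom, Pi.add_apply,
      Pi.neg_apply] at hi
    rw [hi]
    constructor <;> linarith [hyi.1, hyi.2]
  constructor
  · intro h
    obtain ⟨m, hm, h1, h2⟩ := mid F F' h.subset
    obtain ⟨m', hm', h1', -⟩ := mid F' F h.symm.subset
    have e := h2 h1'
    refine Quotient.sound ?_
    change F ∈ AddAction.orbit (lattice ρ) F'
    refine ⟨⟨-m, neg_mem hm⟩, ?_⟩
    change -m +ᵥ F' = F
    rw [e, neg_vadd_vadd]
  · intro h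
    have h' := Quotient.exact h
    change F ∈ AddAction.orbit (lattice ρ) F' at h'
    obtain ⟨⟨m, hm⟩, e⟩ := h'
    have e : m +ᵥ F' = F := e
    subst e
    have hmem : ∀ (F : CubeFace n) (m : Fin n → ℤ), m ∈ lattice ρ →
        (torusImage (m +ᵥ F) : Set (Torus ρ)) ⊆ torusImage F := by
      rintro F m hm _ ⟨x, hx, rfl⟩
      refine ⟨fun i => x i - m i, fun i => ?_, ?_⟩
      · have := hx i
        change ((m i + F.base i : ℤ) : ℝ) ≤ x i ∧
          x i ≤ ((m i + F.base i : ℤ) : ℝ) + (if i ∈ F.dirs then 1 else 0) at this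
        push_cast at this
        constructor <;> linarith [this.1, this.2]
      · refine QuotientAddGroup.eq.mpr ⟨m, hm, ?_⟩
        funext i
        simp
    refine Set.Subset.antisymm (hmem F' m hm) ?_
    have := hmem (m +ᵥ F') (-m) (neg_mem hm)
    rwa [neg_vadd_vadd] at this

/-- The dimension of a cell. -/
def Cell.dim : Cell ρ → ℕ :=
  Quotient.lift (fun F : CubeFace n => F.dirs.card) (by
    rintro _ F ⟨m, rfl⟩
    rfl)

variable (ρ) in
/-- The set `Δ_k` of the cells of dimension `k`. -/
abbrev CellOfDim (k : ℕ) : Type := {η : Cell ρ // η.dim = k}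

/-- A chosen lift of a cell to a face of a unit cube in `ℝⁿ`. All choices differ by a translation
by an element of `M`. -/
def Cell.lift (η : Cell ρ) : CubeFace n := Quotient.out η

theorem Cell.card_lift_dirs (η : Cell ρ) : η.lift.dirs.card = η.dim := by
  conv_rhs => rw [← Quotient.out_eq η]
  rfl

variable (ρ) in
/-- An incidence function `ε` on the toric cell complex. A pair of a cell and one of its faces is
an `M`-orbit of pairs of a face of a unit cube in `ℝⁿ` and one of its faces, so `ε` is given by an
`M`-invariant function on the latter. -/
structure IncidenceFunction where
  toFun : Face n → Face n → ℤ
  values : ∀ F F', toFun F F' = 0 ∨ toFun F F' = 1 ∨ toFun F F' = -1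
  ne_zero_iff : ∀ F F', toFun F F' ≠ 0 ↔ F'.IsFacetOf F
  empty_face : ∀ F : Face n, F.dim = 0 → toFun F none = 1
  sign : ∀ F F'' F₁ F₂ : Face n, F₁ ≠ F₂ → F₁.IsFacetOf F → F₂.IsFacetOf F →
    F''.IsFacetOf F₁ → F''.IsFacetOf F₂ →
      toFun F F₁ * toFun F₁ F'' + toFun F F₂ * toFun F₂ F'' = 0
  invariant : ∀ m ∈ lattice ρ, ∀ F F', toFun (F.translate m) (F'.translate m) = toFun F F'

/-! ## The covering quiver -/

variable (n) in
/-- The vertices of the covering quiver. -/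
def CoverVertex : Type := Fin n → ℤ

/-- The lattice point that is a vertex of the covering quiver. -/
def CoverVertex.val (u : CoverVertex n) : Fin n → ℤ := u

/-- The covering quiver has an arrow from `u` to `u + χ_i` for all `u` and `i`. -/
instance : Quiver (CoverVertex n) where
  Hom u v := {i : Fin n // v.val = u.val + Pi.single i 1}

/-- The paths in the covering quiver between two lattice points. -/
abbrev CoverPath (u v : Fin n → ℤ) : Type := @Quiver.Path (CoverVertex n) _ u v

variable (ρ) in
/-- The vertex of the McKay quiver below a lattice point. As the arrow `u → u + χ_i` has to lie
over an arrow `τ * ρ i → τ`, this is the inverse of `deg u`. -/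
def vertexOf (u : Fin n → ℤ) : Vertex ρ := ((∏ i, ρ i ^ u i)⁻¹ : X)

theorem vertexOf_add_single (u : Fin n → ℤ) (i : Fin n) :
    (vertexOf ρ u).val = (vertexOf ρ (u + Pi.single i 1)).val * ρ i := by
  have : ∏ j, ρ j ^ (u + Pi.single i 1 : Fin n → ℤ) j = (∏ j, ρ j ^ u j) * ρ i := by
    simp only [Pi.add_apply, zpow_add, Finset.prod_mul_distrib]
    congr 1
    rw [Finset.prod_eq_single i]
    · simp
    · intro j _ hj
      simp [hj]
    · intro h
      exact absurd (Finset.mem_univ _) h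
  change (∏ j, ρ j ^ u j)⁻¹ = (∏ j, ρ j ^ (u + Pi.single i 1 : Fin n → ℤ) j)⁻¹ * ρ i
  rw [this, mul_inv_rev, mul_comm (ρ i)⁻¹, inv_mul_cancel_right]

variable (ρ) in
/-- The projection from the covering quiver to the McKay quiver. -/
def coverMap : CoverVertex n ⥤q Vertex ρ where
  obj u := vertexOf ρ u.val
  map {u v} a := ⟨a.1, by
    have ha : v.val = u.val + Pi.single a.1 1 := a.2
    have h := vertexOf_add_single (ρ := ρ) u.val a.1
    rwa [← ha] at h⟩

theorem nonempty_coverPath_aux (N : ℕ) : ∀ u v : Fin n → ℤ, u ≤ v → ∑ i, (v i - u i) = N →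
    Nonempty (CoverPath u v) := by
  induction N with
  | zero =>
    intro u v h hs
    have : ∀ i ∈ Finset.univ, v i - u i = 0 :=
      (Finset.sum_eq_zero_iff_of_nonneg fun i _ => sub_nonneg.mpr (h i)).mp (by simpa using hs)
    have : v = u := funext fun i => sub_eq_zero.mp (this i (Finset.mem_univ i))
    subst this
    exact ⟨Quiver.Path.nil⟩
  | succ N ih =>
    intro u v h hs
    obtain ⟨i, hi⟩ : ∃ i, u i < v i := by
      by_contra hcon
      push Not at hcon
      have : ∑ i, (v i - u i) = 0 :=
        Finset.sum_eq_zero fun i _ => sub_eq_zero.mpr (le_antisymm (hcon i) (h i))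
      rw [this] at hs
      push_cast at hs
      omega
    have hle : u ≤ v - Pi.single i 1 := by
      intro j
      by_cases hj : j = i
      · subst hj
        simp
        omega
      · simpa [hj] using h j
    obtain ⟨p⟩ := ih u (v - Pi.single i 1) hle (by
      have : ∑ j, ((v - Pi.single i 1 : Fin n → ℤ) j - u j) = ∑ j, (v j - u j) - 1 := by
        simp only [Pi.sub_apply, sub_right_comm _ _ (u _), Finset.sum_sub_distrib]
        simp
      rw [this, hs]
      push_cast
      ring)
    exact ⟨Quiver.Path.cons p ⟨i, (sub_add_cancel v (Pi.single i 1)).symm⟩⟩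

/-- There is a path in the covering quiver from `u` to every `v ≥ u`. -/
theorem nonempty_coverPath {u v : Fin n → ℤ} (h : u ≤ v) :
    Nonempty (CoverPath u v) :=
  nonempty_coverPath_aux (∑ i, (v i - u i)).toNat u v h
    (Int.toNat_of_nonneg (Finset.sum_nonneg fun i _ => sub_nonneg.mpr (h i))).symm

/-- The image in the McKay quiver of a path in the covering quiver from `u` to `v`. -/
def coverPath (u v : Fin n → ℤ) (h : u ≤ v) : Quiver.Path (vertexOf ρ u) (vertexOf ρ v) :=
  (coverMap ρ).mapPath (nonempty_coverPath h).some

theorem CubeFace.tail_le_head (F : CubeFace n) : F.tail ≤ F.head := by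
  intro i
  simp only [CubeFace.tail, CubeFace.head]
  split_ifs <;> simp

theorem CubeFace.head_le_of_isFaceOf {F' F : CubeFace n}
    (h : Face.IsFaceOf (some F') (some F)) : F'.head ≤ F.head :=
  ((CubeFace.carrier_subset_iff F' F).mp h).2

theorem CubeFace.tail_le_of_isFaceOf {F' F : CubeFace n}
    (h : Face.IsFaceOf (some F') (some F)) : F.tail ≤ F'.tail :=
  ((CubeFace.carrier_subset_iff F' F).mp h).1

/-- The head of a cell. -/
def Cell.head (η : Cell ρ) : Vertex ρ := vertexOf ρ η.lift.head

/-- The tail of a cell. -/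
def Cell.tail (η : Cell ρ) : Vertex ρ := vertexOf ρ η.lift.tail

/-- The degree of a cell in `Λ₊`: the degree of a path in it from its tail to its head. -/
def Cell.degree (η : Cell ρ) : LamPlus ρ :=
  pathDeg (coverPath η.lift.tail η.lift.head η.lift.tail_le_head : Quiver.Path _ _)

/-- The facets of the chosen lift of a cell. -/
abbrev LiftFacet {j : ℕ} (η : CellOfDim ρ (j + 1)) : Type :=
  {F' : CubeFace n // F' ∈ η.1.lift.facets}

theorem LiftFacet.isFaceOf {j : ℕ} {η : CellOfDim ρ (j + 1)} (F' : LiftFacet η) :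
    Face.IsFaceOf (some F'.1) (some η.1.lift) :=
  ((CubeFace.mem_facets F'.1 η.1.lift).mp F'.2).1

/-- The cell below a facet of the lift. -/
def LiftFacet.cell {j : ℕ} {η : CellOfDim ρ (j + 1)} (F' : LiftFacet η) : CellOfDim ρ j :=
  ⟨toCell ρ F'.1, by
    have h : ((F'.1.dirs.card : ℕ) : ℤ) + 1 = η.1.lift.dirs.card :=
      ((CubeFace.mem_facets F'.1 η.1.lift).mp F'.2).2
    have h1 := Cell.card_lift_dirs η.1
    have h2 := η.2
    change F'.1.dirs.card = j
    omega⟩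

/-! ## The toric algebra of the McKay quiver -/

variable (k : Type*) [Field k] (ρ) [Finite X]

/-- The generating relations of the toric algebra: two paths with the same tail, the same head and
the same divisor are identified. -/
inductive ToricRel : PathAlgebra k (Vertex ρ) → PathAlgebra k (Vertex ρ) → Prop
  | mk {σ τ : Vertex ρ} (p q : Quiver.Path σ τ) (h : pathDiv p = pathDiv q) :
      ToricRel (PathAlgebra.ofPath k _ ⟨σ, τ, p⟩) (PathAlgebra.ofPath k _ ⟨σ, τ, q⟩)

/-- The toric algebra `A`, the quotient of the path algebra of the McKay quiver by the two-sided
ideal generated by the differences of paths with the same tail, head and divisor. -/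
def ToricAlgebra : Type _ := RingQuot (ToricRel ρ k)

instance : Ring (ToricAlgebra ρ k) := inferInstanceAs (Ring (RingQuot (ToricRel ρ k)))
instance : Algebra k (ToricAlgebra ρ k) := inferInstanceAs (Algebra k (RingQuot (ToricRel ρ k)))

variable {ρ}

/-- The class of a path in the toric algebra. -/
def pathClass {σ τ : Vertex ρ} (p : Quiver.Path σ τ) : ToricAlgebra ρ k :=
  RingQuot.mkAlgHom k (ToricRel ρ k) (PathAlgebra.ofPath k _ ⟨σ, τ, p⟩)

/-- The idempotent of a vertex in the toric algebra. -/
def vertexIdem (v : Vertex ρ) : ToricAlgebra ρ k := pathClass k (Quiver.Path.nil : Quiver.Path v v)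


/-- The left derivative of a face with respect to a face `F'` of it: the class of a path from the
head of `F'` to the head of `F`. -/
def leftDeriv {F' F : CubeFace n} (h : Face.IsFaceOf (some F') (some F)) : ToricAlgebra ρ k :=
  pathClass k (coverPath F'.head F.head (CubeFace.head_le_of_isFaceOf h) :
    Quiver.Path (vertexOf ρ F'.head) (vertexOf ρ F.head))

/-- The right derivative of a face with respect to a face `F'` of it: the class of a path from the
tail of `F` to the tail of `F'`. -/
def rightDeriv {F' F : CubeFace n} (h : Face.IsFaceOf (some F') (some F)) : ToricAlgebra ρ k :=
  pathClass k (coverPath F.tail F'.tail (CubeFace.tail_le_of_isFaceOf h) :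
    Quiver.Path (vertexOf ρ F.tail) (vertexOf ρ F'.tail))

variable (ρ)

/-- The enveloping algebra of `A`. A module over it is an `(A,A)`-bimodule on which the two actions
of `k` agree: `(a ⊗ b)` acts on `x` as `a x b`. -/
abbrev Env : Type _ := ToricAlgebra ρ k ⊗[k] (ToricAlgebra ρ k)ᵐᵒᵖ

/-- The `(A,A)`-bimodule `A`, on which `a ⊗ b` acts as `x ↦ a x b`. -/
instance : Module (Env ρ k) (ToricAlgebra ρ k) := TensorProduct.Algebra.module

variable {ρ}

/-- The bimodule `A e_{h(η)} ⊗ [η] ⊗ e_{t(η)} A`, as the left ideal of the enveloping algebra that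
is generated by `e_{h(η)} ⊗ e_{t(η)}`. -/
abbrev summand (η : Cell ρ) : Submodule (Env ρ k) (Env ρ k) :=
  Submodule.span (Env ρ k) {vertexIdem k η.head ⊗ₜ[k] op (vertexIdem k η.tail)}

variable (ρ)

/-- The bimodule `P_j`, the direct sum of the bimodules `A e_{h(η)} ⊗ [η] ⊗ e_{t(η)} A` over all
cells `η` of dimension `j`. -/
abbrev P (j : ℕ) : Type _ := ⨁ η : CellOfDim ρ j, summand k η.1

variable {ρ}

/-- The generator `1 ⊗ [η] ⊗ 1`. -/
def gen {j : ℕ} (η : CellOfDim ρ j) : P ρ k j :=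
  DirectSum.lof (Env ρ k) (CellOfDim ρ j) (fun η => summand k η.1) η
    ⟨_, Submodule.mem_span_singleton_self _⟩

/-- The bimodule homomorphism with prescribed values on generators: on the summand of `η` it is
`y ↦ y • f η`. -/
def ofGen {j : ℕ} {N : Type*} [AddCommMonoid N] [Module (Env ρ k) N]
    (f : CellOfDim ρ j → N) : P ρ k j →ₗ[Env ρ k] N :=
  DirectSum.toModule (Env ρ k) (CellOfDim ρ j) N fun η =>
    (LinearMap.toSpanSingleton (Env ρ k) N (f η)).comp (summand k η.1).subtype

/-- The value of the differential on a generator: the sum over all facets of `η` of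
`ε(η,η')` times `(left derivative) ⊗ [η'] ⊗ (right derivative)`. -/
def boundary (ε : IncidenceFunction ρ) {j : ℕ} (η : CellOfDim ρ (j + 1)) : P ρ k j :=
  ∑ F' : LiftFacet η, ε.toFun (some η.1.lift) (some F'.1) •
    ((leftDeriv k F'.isFaceOf ⊗ₜ[k] op (rightDeriv k F'.isFaceOf) : Env ρ k) • gen k F'.cell)

/-- The differential `P_{j+1} → P_j`. -/
def diff (ε : IncidenceFunction ρ) (j : ℕ) : P ρ k (j + 1) →ₗ[Env ρ k] P ρ k j :=
  ofGen k (boundary k ε)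

variable (ρ)

/-- The multiplication map `P_0 → A`. -/
def mult : P ρ k 0 →ₗ[Env ρ k] ToricAlgebra ρ k :=
  ofGen k fun _ => (1 : ToricAlgebra ρ k)

/-! ## The gradings -/

/-- The homogeneous elements of degree `l` of the toric algebra, spanned by the classes of the
paths of degree `l`. -/
def algGrading (l : LamPlus ρ) : Submodule k (ToricAlgebra ρ k) :=
  Submodule.span k {a | ∃ (σ τ : Vertex ρ) (p : Quiver.Path σ τ), pathDeg p = l ∧ a = pathClass k p}

/-- The homogeneous elements of total degree `l` of `P_j`: the degree of `a ⊗ [η] ⊗ b` is the sum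
of the degrees of `a`, `η` and `b`. -/
def modGrading (j : ℕ) (l : LamPlus ρ) : Submodule k (P ρ k j) :=
  Submodule.span k {x | ∃ (η : CellOfDim ρ j) (a b : ToricAlgebra ρ k) (α β : LamPlus ρ),
    a ∈ algGrading ρ k α ∧ b ∈ algGrading ρ k β ∧ α + η.1.degree + β = l ∧
      x = (a ⊗ₜ[k] op b : Env ρ k) • gen k η}

end McKay

end

noncomputable section

namespace McKay

open QuiverAlg

variable {n : ℕ} {X : Type*} [CommGroup X] {ρ : Fin n → X}

/-! ## Paths, divisors and degrees -/

/-! Gradings. Everything rests on one fact: two paths with the same tail, head and divisor have the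
same class in `Λ` (`pathDeg_eq`). Such paths are connected by moves that exchange two consecutive
arrows with distinct labels `x_i`, `x_j`, so it suffices to treat the two sides of a square. Because
matrices in `SL(n)` have determinant `1`, the characters `ρ i` multiply to `1`. Hence there is a
path `q` back from the end of the square to its start whose divisor is the product of the other
variables. The two sides are exactly the terms of `∂_q W`, and `Λ` identifies them
(`pathDeg_square`). The relations of `A` are therefore homogeneous, and sending a path to itself
tensored with its degree defines a coaction `A → A[Λ₊]`. This coaction separates the degrees, which
proves that `A` is the direct sum of its homogeneous parts. Applied to both tensor factors, with a
shift by the degree of the cell, it does the same for `P_j`. Complex. In the covering quiver the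
divisor of a path is the difference of its endpoints, so its class in `A` depends on these alone.
Derivatives are therefore multiplicative along chains of faces. In `d ∘ d` each codimension-two face
occurs twice, through the two facets containing it, with equal derivatives and opposite signs. The
composite `μ ∘ d₁` vanishes by the same sign rule at the empty face. Comparison. The quotient of two
incidence functions is a sign on each pair of a face and a facet, and its products along the two
ways around a diamond of faces agree. It is thus a coboundary: multiplying it along a chain from a
face down to a vertex gives a sign of the face, and `faceSign_eq` shows that passing to any facet
changes this sign by the quotient. These signs are invariant under `M` and multiplicative in the
incidence functions, so they give coherent isomorphisms. -/

@[simp] theorem pathDiv_nil (σ : Vertex ρ) :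
    pathDiv (Quiver.Path.nil : Quiver.Path σ σ) = 0 := rfl

@[simp] theorem pathDiv_cons {σ τ υ : Vertex ρ} (p : Quiver.Path σ τ) (a : τ ⟶ υ) :
    pathDiv (p.cons a) = pathDiv p + Pi.single a.1 1 := rfl

theorem pathDiv_comp {σ τ υ : Vertex ρ} (p : Quiver.Path σ τ) (q : Quiver.Path τ υ) :
    pathDiv (p.comp q) = pathDiv p + pathDiv q := by
  induction q with
  | nil => simp
  | cons q a ih => rw [Quiver.Path.comp_cons, pathDiv_cons, pathDiv_cons, ih, add_assoc]

theorem pathVec_comp {σ τ υ : Vertex ρ} (p : Quiver.Path σ τ) (q : Quiver.Path τ υ) :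
    pathVec (p.comp q) = pathVec p + pathVec q := by
  induction q with
  | nil => exact (add_zero _).symm
  | cons q a ih =>
    change pathVec (p.comp q) + _ = pathVec p + (pathVec q + _)
    rw [ih, add_assoc]

theorem pathDeg_comp {σ τ υ : Vertex ρ} (p : Quiver.Path σ τ) (q : Quiver.Path τ υ) :
    pathDeg (p.comp q) = pathDeg p + pathDeg q := by
  apply Subtype.ext
  change wtNat ρ (pathVec (p.comp q)) = wtNat ρ (pathVec p) + wtNat ρ (pathVec q)
  rw [pathVec_comp, map_add]

theorem pathDeg_nil (σ : Vertex ρ) : pathDeg (Quiver.Path.nil : Quiver.Path σ σ) = 0 :=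
  Subtype.ext (map_zero (wtNat ρ))

/-- The labels of the arrows of a path, beginning with the initial arrow. -/
def pathLabels {σ : Vertex ρ} : {τ : Vertex ρ} → Quiver.Path σ τ → List (Fin n)
  | _, Quiver.Path.nil => []
  | _, Quiver.Path.cons p a => pathLabels p ++ [a.1]

theorem pathLabels_comp {σ τ υ : Vertex ρ} (p : Quiver.Path σ τ) (q : Quiver.Path τ υ) :
    pathLabels (p.comp q) = pathLabels p ++ pathLabels q := by
  induction q with
  | nil => exact (List.append_nil _).symm
  | cons q a ih =>
    change pathLabels (p.comp q) ++ [a.1] = pathLabels p ++ (pathLabels q ++ [a.1])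
    rw [ih, List.append_assoc]

theorem sum_pathDiv {σ τ : Vertex ρ} (p : Quiver.Path σ τ) : ∑ i, pathDiv p i = p.length := by
  induction p with
  | nil => simp
  | cons p a ih => simp [Finset.sum_add_distrib, ih]

theorem prod_pow_add_single (ρ : Fin n → X) (e : Fin n → ℕ) (i : Fin n) :
    ∏ j, ρ j ^ (e + Pi.single i 1 : Fin n → ℕ) j = ρ i * ∏ j, ρ j ^ e j := by
  simp only [Pi.add_apply, pow_add, Finset.prod_mul_distrib]
  rw [mul_comm]
  congr 1
  rw [Finset.prod_eq_single i]
  · simp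
  · intro j _ hj
    simp [hj]
  · intro h
    exact absurd (Finset.mem_univ _) h

/-- The divisor of a path determines its tail from its head. -/
theorem tail_eq_head_mul {σ τ : Vertex ρ} (p : Quiver.Path σ τ) :
    σ.val = τ.val * ∏ i, ρ i ^ pathDiv p i := by
  induction p with
  | nil => simp
  | @cons υ τ p a ih =>
    have ha : υ.val = τ.val * ρ a.1 := a.2
    rw [pathDiv_cons, prod_pow_add_single, ih, ← mul_assoc, ← ha]

/-- There is a path with given head and given divisor. -/
theorem exists_path_of_sum (N : ℕ) : ∀ (σ τ : Vertex ρ) (d : Fin n → ℕ), ∑ i, d i = N →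
    σ.val = τ.val * ∏ i, ρ i ^ d i → ∃ p : Quiver.Path σ τ, pathDiv p = d := by
  induction N with
  | zero =>
    intro σ τ d hd h
    have : d = 0 := funext fun i => (Finset.sum_eq_zero_iff.mp hd) i (Finset.mem_univ i)
    subst this
    have h : σ.val = τ.val := h.trans (by simp)
    have h : σ = τ := h
    subst h
    exact ⟨Quiver.Path.nil, rfl⟩
  | succ N ih =>
    intro σ τ d hd h
    obtain ⟨i, hi⟩ : ∃ i, d i ≠ 0 := by
      by_contra! hcon
      simp [hcon] at hd
    obtain ⟨e, rfl⟩ : ∃ e : Fin n → ℕ, d = e + Pi.single i 1 := by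
      refine ⟨d - Pi.single i 1, funext fun j => ?_⟩
      by_cases hj : j = i
      · subst hj
        simp
        omega
      · simp [hj]
    let υ : Vertex ρ := (τ.val * ρ i : X)
    obtain ⟨p, hp⟩ := ih σ υ e (by
      simp only [Pi.add_apply, Finset.sum_add_distrib] at hd
      simpa using hd) (by
        rw [h, prod_pow_add_single, ← mul_assoc]; rfl)
    exact ⟨p.cons ⟨i, rfl⟩, by rw [pathDiv_cons, hp]⟩

theorem exists_path {σ τ : Vertex ρ} (d : Fin n → ℕ)
    (h : σ.val = τ.val * ∏ i, ρ i ^ d i) : ∃ p : Quiver.Path σ τ, pathDiv p = d :=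
  exists_path_of_sum _ σ τ d rfl h

theorem arrow_ext {σ τ : Vertex ρ} {a b : σ ⟶ τ} (h : a.1 = b.1) : a = b := Subtype.ext h

theorem single_add_single_eq {i j a b : Fin n}
    (h : (Pi.single a 1 + Pi.single b 1 : Fin n → ℕ) = Pi.single i 1 + Pi.single j 1) :
    (a = i ∧ b = j) ∨ (a = j ∧ b = i) := by
  have h1 := congrFun h i
  have h2 := congrFun h j
  have h3 := congrFun h a
  have h4 := congrFun h b
  simp only [Pi.add_apply, Pi.single_apply] at h1 h2 h3 h4
  by_cases e1 : a = i <;> by_cases e2 : b = j <;> by_cases e3 : a = j <;> by_cases e4 : b = i <;>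
    simp_all [eq_comm]

/-- A path with two arrows of labels `i` and `j` is one of the two sides of a square. -/
theorem eq_of_pathDiv_eq_single_add_single {σ υ υ' τ : Vertex ρ} {i j : Fin n}
    (a : σ ⟶ υ) (b : υ ⟶ τ) (a' : σ ⟶ υ') (b' : υ' ⟶ τ) (ha : a.1 = i) (hb : b.1 = j)
    (ha' : a'.1 = j) (hb' : b'.1 = i) (p : Quiver.Path σ τ)
    (hp : pathDiv p = Pi.single i 1 + Pi.single j 1) :
    p = (Quiver.Path.nil.cons a).cons b ∨ p = (Quiver.Path.nil.cons a').cons b' := by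
  have hlen : p.length = 2 := by
    rw [← sum_pathDiv, hp]
    simp [Finset.sum_add_distrib]
  match p, hp, hlen with
  | Quiver.Path.cons (b := ω) (Quiver.Path.cons Quiver.Path.nil c) d, hp, _ =>
    have hp : (Pi.single c.1 1 + Pi.single d.1 1 : Fin n → ℕ) = Pi.single i 1 + Pi.single j 1 := by
      simpa using hp
    have hd : ω = (τ.val * ρ d.1 : X) := d.2
    have hυ : υ = (τ.val * ρ b.1 : X) := b.2
    -- The head and the label of the last arrow determine the middle vertex, so the order of the two
    -- labels determines the path.
    have hυ' : υ' = (τ.val * ρ b'.1 : X) := b'.2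
    rcases single_add_single_eq hp with ⟨h1, h2⟩ | ⟨h1, h2⟩
    · left
      have : ω = υ := by rw [hd, hυ, h2, hb]
      subst this
      rw [arrow_ext (h1.trans ha.symm), arrow_ext (h2.trans hb.symm)]
    · right
      have : ω = υ' := by rw [hd, hυ', h2, hb']
      subst this
      rw [arrow_ext (h1.trans ha'.symm), arrow_ext (h2.trans hb'.symm)]
  | Quiver.Path.cons (Quiver.Path.cons (Quiver.Path.cons _ _) _) _, _, h =>
    simp at h

/-! ### Squares in the quiver, and the degree as a function of endpoints and divisor -/

theorem wtNat_eq_of_mem {v w : Arrow ρ →₀ ℕ}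
    (h : natToInt ρ v - natToInt ρ w ∈ superpotentialVectors ρ) : wtNat ρ v = wtNat ρ w := by
  refine QuotientAddGroup.eq.mpr ?_
  have := neg_mem (AddSubgroup.subset_closure h)
  rw [neg_sub] at this
  rwa [neg_add_eq_sub]

/-- The two sides of a square have the same degree. -/
theorem pathDeg_square (hρ : ∏ i, ρ i = 1) {σ υ υ' τ : Vertex ρ} {i j : Fin n} (hij : i ≠ j)
    (a : σ ⟶ υ) (b : υ ⟶ τ) (a' : σ ⟶ υ') (b' : υ' ⟶ τ) (ha : a.1 = i) (hb : b.1 = j)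
    (ha' : a'.1 = j) (hb' : b'.1 = i) :
    pathDeg ((Quiver.Path.nil.cons a).cons b) = pathDeg ((Quiver.Path.nil.cons a').cons b') := by
  have hdiv : pathDiv ((Quiver.Path.nil.cons a).cons b) = Pi.single i 1 + Pi.single j 1 := by
    simp [ha, hb]
  have hdiv' : pathDiv ((Quiver.Path.nil.cons a').cons b') = Pi.single i 1 + Pi.single j 1 := by
    simp [ha', hb', add_comm]
  -- `e` is the divisor of the product of all variables except `x_i` and `x_j`.
  obtain ⟨e, he⟩ : ∃ e : Fin n → ℕ, e + (Pi.single i 1 + Pi.single j 1) = fun _ => 1 := by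
    refine ⟨fun l => if l = i ∨ l = j then 0 else 1, funext fun l => ?_⟩
    simp only [Pi.add_apply, Pi.single_apply]
    by_cases h1 : l = i
    · subst h1; simp [hij]
    · by_cases h2 : l = j
      · subst h2; simp [hij.symm]
      · simp [h1, h2]
  -- A path with divisor `e` that starts at `τ` ends at `σ` because the `ρ l` multiply to `1`.
  obtain ⟨q, hq⟩ : ∃ q : Quiver.Path τ σ, pathDiv q = e := by
    apply exists_path
    have h1 := tail_eq_head_mul ((Quiver.Path.nil.cons a).cons b)
    rw [h1, hdiv, mul_assoc, ← Finset.prod_mul_distrib]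
    have : ∏ l, ρ l ^ (Pi.single i 1 + Pi.single j 1 : Fin n → ℕ) l * ρ l ^ e l = ∏ l, ρ l := by
      refine Finset.prod_congr rfl fun l _ => ?_
      have := congrFun he l
      rw [← pow_add, add_comm, ← Pi.add_apply, this, pow_one]
    simp only [this, hρ, mul_one]
  apply Subtype.ext
  refine wtNat_eq_of_mem ⟨τ, σ, q, _, _, ?_, ?_, ?_, ?_, rfl⟩
  · intro h
    obtain ⟨h1, -, h2⟩ := Quiver.Path.cons.inj h
    subst h1
    exact hij (hb'.symm.trans ((congrArg Subtype.val (eq_of_heq h2)).symm.trans hb))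
  · ext p
    simp only [derivTerms, IsAnticanonical, Set.mem_ofPred_eq, Set.mem_insert_iff,
      Set.mem_singleton_iff, pathDiv_comp, hq, ← he]
    rw [add_right_inj]
    constructor
    · exact eq_of_pathDiv_eq_single_add_single a b a' b' ha hb ha' hb' p
    · rintro (rfl | rfl)
      · exact hdiv
      · exact hdiv'
  -- Paths are built up from their final arrow, so a common initial arrow is detected on the lists
  -- of labels, which would both have to begin with its label.
  · rintro ⟨ω, c, p', q', h1, h2⟩
    have h1 := congrArg pathLabels h1
    have h2 := congrArg pathLabels h2
    simp only [pathLabels_comp, Quiver.Hom.toPath, pathLabels, List.nil_append,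
      List.cons_append, List.cons.injEq] at h1 h2
    exact hij (ha.symm.trans (h1.1.trans (h2.1.symm.trans ha')))
  · rintro ⟨ω, c, p', q', h1, h2⟩
    obtain ⟨e1, -, e2⟩ := Quiver.Path.cons.inj h1
    obtain ⟨e1', -, e2'⟩ := Quiver.Path.cons.inj h2
    subst e1
    subst e1'
    have e2 := congrArg Subtype.val (eq_of_heq e2)
    have e2' := congrArg Subtype.val (eq_of_heq e2')
    exact hij (hb'.symm.trans (e2'.trans (e2.symm.trans hb)))

/-- Two paths with the same tail, head and divisor have the same degree. -/
theorem pathDeg_eq_of_length (hρ : ∏ i, ρ i = 1) (N : ℕ) : ∀ (σ τ : Vertex ρ)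
    (p q : Quiver.Path σ τ), p.length = N → pathDiv p = pathDiv q → pathDeg p = pathDeg q := by
  induction N with
  | zero =>
    intro σ τ p q hp h
    have hq : q.length = 0 := by rw [← sum_pathDiv, ← h, sum_pathDiv, hp]
    obtain rfl := Quiver.Path.eq_of_length_zero p hp
    rw [Quiver.Path.eq_nil_of_length_zero p hp, Quiver.Path.eq_nil_of_length_zero q hq]
  | succ N ih =>
    intro σ τ p q hp h
    have hq : q.length = N + 1 := by rw [← sum_pathDiv, ← h, sum_pathDiv, hp]
    match p, q, hp, hq, h with
    | Quiver.Path.cons (b := υ) p a, Quiver.Path.cons (b := υ') q b, hp, hq, h =>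
    have hp : p.length = N := by simpa using hp
    have hq : q.length = N := by simpa using hq
    have hυ : υ = (τ.val * ρ a.1 : X) := a.2
    have hυ' : υ' = (τ.val * ρ b.1 : X) := b.2
    rw [pathDiv_cons, pathDiv_cons] at h
    have hcons : ∀ {σ τ υ : Vertex ρ} (p : Quiver.Path σ τ) (a : τ ⟶ υ),
        pathDeg (p.cons a) = pathDeg p + pathDeg (Quiver.Path.nil.cons a) :=
      fun p a => pathDeg_comp p (Quiver.Path.nil.cons a)
    by_cases hab : a.1 = b.1
    · have : υ = υ' := by rw [hυ, hυ', hab]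
      subst this
      rw [hab] at h
      rw [hcons p, hcons q, ih _ _ p q hp (add_right_cancel h), arrow_ext hab]
    -- The final labels differ, so each of the two shorter paths also contains the final label of
    -- the other. With a common path `r` of divisor `e`, both paths are compared with `r` followed
    -- by one side of a square; the induction hypothesis handles everything before the final arrows.
    · obtain ⟨e, he⟩ : ∃ e : Fin n → ℕ, pathDiv p = e + Pi.single b.1 1 := by
        refine ⟨pathDiv p - Pi.single b.1 1, funext fun l => ?_⟩
        have := congrFun h l
        by_cases hl : l = b.1
        · subst hl
          simp [Ne.symm hab] at this ⊢
          omega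
        · simp [hl]
      have he' : pathDiv q = e + Pi.single a.1 1 := by
        rw [he, add_right_comm] at h
        exact (add_right_cancel h).symm
      let ω : Vertex ρ := (υ.val * ρ b.1 : X)
      have hω : ω.val = υ'.val * ρ a.1 := by
        change υ.val * ρ b.1 = υ'.val * ρ a.1
        exact (congrArg (· * ρ b.1) a.2).trans ((mul_right_comm _ _ _).trans
          (congrArg (· * ρ a.1) b.2).symm)
      let c : ω ⟶ υ := ⟨b.1, rfl⟩
      let c' : ω ⟶ υ' := ⟨a.1, hω⟩
      obtain ⟨r, hr⟩ : ∃ r : Quiver.Path σ ω, pathDiv r = e := by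
        apply exists_path
        have := tail_eq_head_mul p
        rw [this]
        change _ = υ.val * ρ b.1 * _
        rw [mul_assoc, he, prod_pow_add_single]
      rw [hcons p, hcons q, ih _ _ p (r.cons c) hp (by rw [he, pathDiv_cons, hr]),
        ih _ _ q (r.cons c') hq (by rw [he', pathDiv_cons, hr]), hcons r, hcons r,
        add_assoc, add_assoc]
      congr 1
      have := pathDeg_square hρ hab c' b c a rfl rfl rfl rfl
      rw [hcons, hcons _ a] at this
      exact this.symm

/-- The endpoints are only assumed propositionally equal, since translation by `M` changes lattice
points without changing the vertices below them. -/
theorem pathDeg_eq (hρ : ∏ i, ρ i = 1) {σ τ σ' τ' : Vertex ρ} (p : Quiver.Path σ τ)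
    (q : Quiver.Path σ' τ') (hσ : σ = σ') (hτ : τ = τ') (h : pathDiv p = pathDiv q) :
    pathDeg p = pathDeg q := by
  subst hσ
  subst hτ
  exact pathDeg_eq_of_length hρ _ _ _ p q rfl h

end McKay

/-- A family of submodules which spans the module is a direct sum decomposition if there are
linear maps that record the degrees of homogeneous elements. -/
theorem DirectSum.isInternal_of_linearMap_single {k M N L ι : Type*} [Semiring k]
    [AddCommMonoid M] [Module k M] [AddCommMonoid N] [Module k N] [DecidableEq L]
    (A : L → Submodule k M) (htop : ⨆ l, A l = ⊤) (f : ι → M →ₗ[k] N)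
    (hf : ∀ x y, (∀ i, f i x = f i y) → x = y) (C : ι → N →ₗ[k] (L →₀ N))
    (hC : ∀ i l, ∀ x ∈ A l, C i (f i x) = Finsupp.single l (f i x)) :
    DirectSum.IsInternal A := by
  -- `C i ∘ f i` recovers the image under `f i` of every component from the sum of the components.
  -- As the `f i` are jointly injective, the sum determines the components.
  have key : ∀ (i : ι) (x : Π₀ l, A l) (l : L),
      C i (f i (DFinsupp.lsum ℕ (fun l => (A l).subtype) x)) l = f i (x l) := by
    intro i x l
    induction x using DFinsupp.induction with
    | h0 => simp
    | ha m y x _ _ ih =>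
      rw [map_add, map_add, map_add, Finsupp.add_apply, ih, DFinsupp.add_apply]
      rw [Submodule.coe_add, map_add, DFinsupp.lsum_single, Submodule.subtype_apply,
        hC i m _ y.2]
      congr 1
      by_cases h : m = l
      · subst h; simp
      · simp [h]
  constructor
  · intro x y hxy
    have hxy : DFinsupp.lsum ℕ (fun l => (A l).subtype) x =
      DFinsupp.lsum ℕ (fun l => (A l).subtype) y := hxy
    refine DFinsupp.ext fun l => Subtype.ext (hf _ _ fun i => ?_)
    rw [← key, ← key, hxy]
  · intro x
    have hx : x ∈ ⨆ l, A l := by rw [htop]; exact Submodule.mem_top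
    rw [Submodule.iSup_eq_range_dfinsupp_lsum] at hx
    exact hx

/-! ### Algebra homomorphisms out of a path algebra -/

namespace QuiverAlg

/-- The algebra homomorphism on a path algebra with prescribed multiplicative values on paths. -/
def PathAlgebra.liftAlgHom {k : Type*} [Field k] {V : Type*} [Quiver V] [Finite V] {B : Type*}
    [Ring B] [Algebra k B] (f : QPath V → B)
    (hone : (letI := Fintype.ofFinite V; ∑ v : V, f ⟨v, v, Quiver.Path.nil⟩) = 1)
    (hmul : ∀ {a b c : V} (p : Quiver.Path b c) (q : Quiver.Path a b),
      f ⟨a, c, q.comp p⟩ = f ⟨b, c, p⟩ * f ⟨a, b, q⟩)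
    (hzero : ∀ p q : QPath V, q.head ≠ p.tail → f p * f q = 0) : PathAlgebra k V →ₐ[k] B :=
  AlgHom.ofLinearMap (PathAlgebra.lift k V f)
    (by
      rw [PathAlgebra.one_def, map_sum]
      simp only [PathAlgebra.idem, PathAlgebra.lift_ofPath]
      exact hone)
    (by
      intro x y
      induction x using PathAlgebra.induction with
      | h0 => simp
      | hadd x x' hx hx' => rw [add_mul, map_add, hx, hx', map_add, add_mul]
      | hs c p =>
      induction y using PathAlgebra.induction with
      | h0 => simp
      | hadd x x' hx hx' => rw [mul_add, map_add, hx, hx', map_add, mul_add]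
      | hs d q =>
      rw [smul_mul_smul_comm, map_smul, map_smul, map_smul, smul_mul_smul_comm]
      congr 1
      simp only [PathAlgebra.lift_ofPath]
      obtain ⟨pt, ph, p⟩ := p
      obtain ⟨qt, qh, q⟩ := q
      by_cases h : qh = pt
      · subst h
        rw [PathAlgebra.ofPath_mul_of_eq, PathAlgebra.lift_ofPath, hmul]
      · rw [PathAlgebra.ofPath_mul_of_ne h, map_zero, hzero _ _ h])

theorem PathAlgebra.liftAlgHom_ofPath {k : Type*} [Field k] {V : Type*} [Quiver V] [Finite V]
    {B : Type*} [Ring B] [Algebra k B] (f : QPath V → B) (hone) (hmul) (hzero) (p : QPath V) :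
    PathAlgebra.liftAlgHom (k := k) f hone hmul hzero (PathAlgebra.ofPath k V p) = f p :=
  PathAlgebra.lift_ofPath k V f p

end QuiverAlg

namespace McKay

open QuiverAlg

variable {n : ℕ} {X : Type*} [CommGroup X] {ρ : Fin n → X}

/-! ## The toric algebra and its grading -/

section ToricAlgebra

variable (k : Type*) [Field k] [Finite X]

theorem pathClass_mul {σ τ υ : Vertex ρ} (p : Quiver.Path τ υ) (q : Quiver.Path σ τ) :
    pathClass k p * pathClass k q = pathClass k (q.comp p) := by
  have h := map_mul (RingQuot.mkAlgHom k (ToricRel ρ k)) (PathAlgebra.ofPath k _ ⟨τ, υ, p⟩)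
    (PathAlgebra.ofPath k _ ⟨σ, τ, q⟩)
  rw [PathAlgebra.ofPath_mul_of_eq] at h
  exact h.symm

theorem pathClass_mul_of_ne {σ τ σ' τ' : Vertex ρ} (p : Quiver.Path σ τ)
    (q : Quiver.Path σ' τ') (h : τ' ≠ σ) : pathClass k p * pathClass k q = 0 := by
  have e := map_mul (RingQuot.mkAlgHom k (ToricRel ρ k)) (PathAlgebra.ofPath k _ ⟨σ, τ, p⟩)
    (PathAlgebra.ofPath k _ ⟨σ', τ', q⟩)
  rw [PathAlgebra.ofPath_mul_of_ne h, map_zero] at e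
  exact e.symm

theorem pathClass_eq {σ τ σ' τ' : Vertex ρ} (p : Quiver.Path σ τ) (q : Quiver.Path σ' τ')
    (hσ : σ = σ') (hτ : τ = τ') (h : pathDiv p = pathDiv q) : pathClass k p = pathClass k q := by
  subst hσ
  subst hτ
  exact RingQuot.mkAlgHom_rel k (ToricRel.mk p q h)

theorem vertexIdem_mul_pathClass {σ τ : Vertex ρ} (p : Quiver.Path σ τ) :
    vertexIdem k τ * pathClass k p = pathClass k p := pathClass_mul k _ p

theorem pathClass_mul_vertexIdem {σ τ : Vertex ρ} (p : Quiver.Path σ τ) :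
    pathClass k p * vertexIdem k σ = pathClass k p := by
  rw [vertexIdem, pathClass_mul, Quiver.Path.nil_comp]

variable (ρ) in
theorem sum_vertexIdem : (letI := Fintype.ofFinite (Vertex ρ); ∑ v, vertexIdem k v) =
    (1 : ToricAlgebra ρ k) := by
  have := map_one (RingQuot.mkAlgHom k (ToricRel ρ k))
  rw [PathAlgebra.one_def, map_sum] at this
  exact this

variable (ρ) in
theorem span_pathClass : Submodule.span k {a : ToricAlgebra ρ k |
    ∃ (σ τ : Vertex ρ) (p : Quiver.Path σ τ), a = pathClass k p} = ⊤ := by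
  rw [eq_top_iff]
  rintro a -
  obtain ⟨x, rfl⟩ := RingQuot.mkAlgHom_surjective k (ToricRel ρ k) a
  induction x using PathAlgebra.induction with
  | h0 => rw [map_zero]; exact zero_mem _
  | hadd x y hx hy => rw [map_add]; exact add_mem hx hy
  | hs c p =>
    rw [map_smul]
    exact Submodule.smul_mem _ _ (Submodule.subset_span ⟨p.tail, p.head, p.path, rfl⟩)

variable {k} in
theorem pathClass_mem_algGrading {σ τ : Vertex ρ} (p : Quiver.Path σ τ) :
    pathClass k p ∈ algGrading ρ k (pathDeg p) :=
  Submodule.subset_span ⟨σ, τ, p, rfl, rfl⟩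

variable (ρ) in
theorem iSup_algGrading : ⨆ l, algGrading ρ k l = ⊤ := by
  rw [eq_top_iff, ← span_pathClass, Submodule.span_le]
  rintro _ ⟨σ, τ, p, rfl⟩
  exact Submodule.mem_iSup_of_mem _ (pathClass_mem_algGrading p)

instance : SetLike.GradedMonoid (algGrading ρ k) where
  one_mem := by
    rw [← sum_vertexIdem]
    refine Submodule.sum_mem _ fun v _ => ?_
    exact Submodule.subset_span ⟨v, v, Quiver.Path.nil, pathDeg_nil v, rfl⟩
  mul_mem := by
    intro α β a b ha hb
    have hle : algGrading ρ k α * algGrading ρ k β ≤ algGrading ρ k (α + β) := by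
      rw [algGrading, algGrading, Submodule.span_mul_span, Submodule.span_le]
      rintro _ ⟨_, ⟨σ, τ, p, rfl, rfl⟩, _, ⟨σ', τ', q, rfl, rfl⟩, rfl⟩
      by_cases h : τ' = σ
      · subst h
        change pathClass k p * pathClass k q ∈ _
        rw [pathClass_mul, add_comm, ← pathDeg_comp]
        exact pathClass_mem_algGrading _
      · change pathClass k p * pathClass k q ∈ _
        rw [pathClass_mul_of_ne k p q h]
        exact zero_mem _
    exact hle (Submodule.mul_mem_mul ha hb)

/-- The coaction of `Λ₊` on the toric algebra, which records the degrees. -/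
def coaction (hρ : ∏ i, ρ i = 1) :
    ToricAlgebra ρ k →ₐ[k] AddMonoidAlgebra (ToricAlgebra ρ k) (LamPlus ρ) :=
  RingQuot.liftAlgHom k ⟨PathAlgebra.liftAlgHom
    (fun p => AddMonoidAlgebra.single (pathDeg p.path) (pathClass k p.path))
    (by
      simp only [pathDeg_nil]
      rw [AddMonoidAlgebra.one_def, ← sum_vertexIdem]
      exact (map_sum (AddMonoidAlgebra.singleAddHom (0 : LamPlus ρ)) _ _).symm)
    (by
      intro a b c p q
      dsimp only
      rw [AddMonoidAlgebra.single_mul_single, pathClass_mul, pathDeg_comp, add_comm])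
    (by
      intro p q h
      rw [AddMonoidAlgebra.single_mul_single, pathClass_mul_of_ne k _ _ h,
        AddMonoidAlgebra.single_zero]),
    by
      rintro _ _ ⟨p, q, h⟩
      simp only [PathAlgebra.liftAlgHom_ofPath]
      -- The coaction respects the toric relations precisely because the divisor determines the
      -- degree.
      rw [pathDeg_eq hρ p q rfl rfl h, pathClass_eq k p q rfl rfl h]⟩

theorem coaction_pathClass (hρ : ∏ i, ρ i = 1) {σ τ : Vertex ρ} (p : Quiver.Path σ τ) :
    coaction k hρ (pathClass k p) = AddMonoidAlgebra.single (pathDeg p) (pathClass k p) := by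
  unfold coaction pathClass
  exact (RingQuot.liftAlgHom_mkAlgHom_apply _ _ _ _).trans (PathAlgebra.liftAlgHom_ofPath _ _ _ _ _)

/-- The linear map that records the degrees of the homogeneous components. -/
def coactionFinsupp (hρ : ∏ i, ρ i = 1) :
    ToricAlgebra ρ k →ₗ[k] (LamPlus ρ →₀ ToricAlgebra ρ k) where
  toFun a := (coaction k hρ a).coeff
  map_add' a b := by rw [map_add, AddMonoidAlgebra.coeff_add]
  map_smul' c a := by rw [map_smul, AddMonoidAlgebra.coeff_smul]; rfl

theorem coactionFinsupp_of_mem (hρ : ∏ i, ρ i = 1) {l : LamPlus ρ} {a : ToricAlgebra ρ k}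
    (ha : a ∈ algGrading ρ k l) : coactionFinsupp k hρ a = Finsupp.single l a := by
  induction ha using Submodule.span_induction with
  | mem a h =>
    obtain ⟨σ, τ, p, rfl, rfl⟩ := h
    change (coaction k hρ (pathClass k p)).coeff = _
    rw [coaction_pathClass, AddMonoidAlgebra.coeff_single]
  | zero => simp
  | add x y _ _ hx hy => rw [map_add, hx, hy, Finsupp.single_add]
  | smul c x _ hx => rw [map_smul, hx, Finsupp.smul_single]

theorem isInternal_algGrading (hρ : ∏ i, ρ i = 1) :
    DirectSum.IsInternal (algGrading ρ k) :=
  DirectSum.isInternal_of_linearMap_single (ι := Unit) _ (iSup_algGrading ρ k)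
    (fun _ => LinearMap.id) (fun _ _ h => h ()) (fun _ => coactionFinsupp k hρ)
    fun _ _ _ hx => coactionFinsupp_of_mem k hρ hx

end ToricAlgebra

/-! ## The bimodules `P_j` and their gradings -/

section Bimodule

variable (k : Type*) [Field k] [Finite X]

/-- The additive structure of `P_j`. -/
abbrev instPAddCommMonoid (j : ℕ) : AddCommMonoid (P ρ k j) := inferInstance

/-- The module structure of `P_j` over the enveloping algebra. -/
abbrev instPModule (j : ℕ) : Module (Env ρ k) (P ρ k j) := inferInstance

/-- The vector space structure of `P_j`. -/
abbrev instPModuleField (j : ℕ) : Module k (P ρ k j) := inferInstance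

attribute [local instance] instPAddCommMonoid instPModule instPModuleField

/-- The addition of `P_j`. -/
abbrev instPAdd (j : ℕ) : Add (P ρ k j) := (instPAddCommMonoid k j).toAdd

/-- The zero of `P_j`. -/
abbrev instPZero (j : ℕ) : Zero (P ρ k j) := (instPAddCommMonoid k j).toZero

attribute [local instance] instPAdd instPZero

theorem P_zero_smul {j : ℕ} (x : P ρ k j) : (0 : Env ρ k) • x = 0 :=
  (instPModule k j).zero_smul x

theorem P_smul_zero {j : ℕ} (y : Env ρ k) : y • (0 : P ρ k j) = 0 :=
  (instPModule k j).smul_zero y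

theorem P_smul_add {j : ℕ} (y : Env ρ k) (x z : P ρ k j) : y • (x + z) = y • x + y • z :=
  (instPModule k j).smul_add y x z

theorem P_add_smul {j : ℕ} (y z : Env ρ k) (x : P ρ k j) : (y + z) • x = y • x + z • x :=
  (instPModule k j).add_smul y z x

theorem P_smul_smul {j : ℕ} (y z : Env ρ k) (x : P ρ k j) : y • z • x = (y * z) • x :=
  ((instPModule k j).mul_smul y z x).symm

theorem P_one_smul {j : ℕ} (x : P ρ k j) : (1 : Env ρ k) • x = x :=
  (instPModule k j).one_smul x

/-- The graded parts are `k`-subspaces while the maps are linear over the enveloping algebra; this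
lets scalars pass through them. -/
theorem P_field_smul {j : ℕ} (c : k) (x : P ρ k j) : c • x = algebraMap k (Env ρ k) c • x :=
  DFinsupp.ext fun η => Subtype.ext (Algebra.smul_def c (x η : Env ρ k))

theorem P_zsmul {j : ℕ} (z : ℤ) (x : P ρ k j) : z • x = (z : Env ρ k) • x :=
  DFinsupp.ext fun η => Subtype.ext (zsmul_eq_mul (x η : Env ρ k) z)

theorem vertexIdem_mul_self (v : Vertex ρ) : vertexIdem k v * vertexIdem k v = vertexIdem k v :=
  vertexIdem_mul_pathClass k _

variable {k} in
theorem env_tmul_mul_tmul (a b c d : ToricAlgebra ρ k) :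
    (a ⊗ₜ[k] op b : Env ρ k) * (c ⊗ₜ[k] op d) = (a * c) ⊗ₜ[k] op (d * b) := by
  rw [Algebra.TensorProduct.tmul_mul_tmul, op_mul]

variable {k} in
theorem env_tmul_smul (a b x : ToricAlgebra ρ k) : (a ⊗ₜ[k] op b : Env ρ k) • x = a * x * b := by
  change a • op b • x = _
  rw [smul_eq_mul, op_smul_eq_mul, mul_assoc]

/-- The generator is the element `e_{h(η)} ⊗ e_{t(η)}` of the enveloping algebra rather than its
unit, so the prescribed value is attained only if these idempotents fix it. -/
theorem ofGen_gen {j : ℕ} {N : Type*} [AddCommMonoid N] [Module (Env ρ k) N]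
    (f : CellOfDim ρ j → N) (η : CellOfDim ρ j) : ofGen k f (gen k η) =
      (vertexIdem k η.1.head ⊗ₜ[k] op (vertexIdem k η.1.tail) : Env ρ k) • f η := by
  unfold ofGen gen
  rw [DirectSum.toModule_lof]
  rfl

theorem idem_smul_gen {j : ℕ} (η : CellOfDim ρ j) :
    (vertexIdem k η.1.head ⊗ₜ[k] op (vertexIdem k η.1.tail) : Env ρ k) • gen k η = gen k η := by
  unfold gen
  rw [← map_smul]
  congr 1
  apply Subtype.ext
  change (vertexIdem k η.1.head ⊗ₜ[k] op (vertexIdem k η.1.tail) : Env ρ k) *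
    (vertexIdem k η.1.head ⊗ₜ[k] op (vertexIdem k η.1.tail)) = _
  rw [env_tmul_mul_tmul, vertexIdem_mul_self, vertexIdem_mul_self]

variable {k}

/-- Bimodule homomorphisms are determined by their values on the generators. -/
theorem P_hom_ext {j : ℕ} {N : Type*} [AddCommMonoid N] [Module (Env ρ k) N]
    {f g : P ρ k j →ₗ[Env ρ k] N} (h : ∀ η, f (gen k η) = g (gen k η)) : f = g := by
  refine DirectSum.linearMap_ext _ fun η => LinearMap.ext fun y => ?_
  obtain ⟨y, hy⟩ := y
  obtain ⟨a, rfl⟩ := Submodule.mem_span_singleton.mp hy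
  have e : (⟨a • (vertexIdem k η.1.head ⊗ₜ[k] op (vertexIdem k η.1.tail)), hy⟩ : summand k η.1) =
      a • ⟨_, Submodule.mem_span_singleton_self _⟩ := rfl
  rw [e, map_smul, map_smul]
  congr 1
  exact h η

variable (ρ k) in
theorem span_gen (j : ℕ) : Submodule.span (Env ρ k) (Set.range (gen k : CellOfDim ρ j → P ρ k j))
    = ⊤ := by
  rw [eq_top_iff]
  rintro x -
  induction x using DirectSum.induction_on with
  | zero => exact zero_mem _
  | add x y hx hy => exact add_mem hx hy
  | of η y =>
    obtain ⟨y, hy⟩ := y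
    obtain ⟨a, rfl⟩ := Submodule.mem_span_singleton.mp hy
    have e : (⟨a • (vertexIdem k η.1.head ⊗ₜ[k] op (vertexIdem k η.1.tail)), hy⟩ :
        summand k η.1) = a • ⟨_, Submodule.mem_span_singleton_self _⟩ := rfl
    change DirectSum.lof (Env ρ k) _ (fun η : CellOfDim ρ j => summand k η.1) η _ ∈ _
    rw [e, map_smul]
    exact Submodule.smul_mem _ _ (Submodule.subset_span ⟨η, rfl⟩)

theorem tmul_smul_gen_mem_modGrading {j : ℕ} (η : CellOfDim ρ j) {a b : ToricAlgebra ρ k}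
    {α β l : LamPlus ρ} (ha : a ∈ algGrading ρ k α) (hb : b ∈ algGrading ρ k β)
    (h : α + η.1.degree + β = l) :
    (a ⊗ₜ[k] op b : Env ρ k) • gen k η ∈ modGrading ρ k j l :=
  Submodule.subset_span ⟨η, a, b, α, β, ha, hb, h, rfl⟩

/-- Every element of the toric algebra is a sum of homogeneous ones. -/
theorem algGrading_induction {C : ToricAlgebra ρ k → Prop} (a : ToricAlgebra ρ k) (h0 : C 0)
    (hadd : ∀ a b, C a → C b → C (a + b)) (h : ∀ l, ∀ a ∈ algGrading ρ k l, C a) : C a :=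
  Submodule.iSup_induction (algGrading ρ k) (motive := C)
    (by rw [iSup_algGrading]; exact Submodule.mem_top) h h0 hadd

variable (ρ k) in
theorem iSup_modGrading (j : ℕ) : ⨆ l, modGrading ρ k j l = ⊤ := by
  rw [eq_top_iff]
  rintro x -
  have hx : x ∈ Submodule.span (Env ρ k) (Set.range (gen k : CellOfDim ρ j → P ρ k j)) := by
    rw [span_gen]; exact Submodule.mem_top
  have key : ∀ (y : Env ρ k) (η : CellOfDim ρ j),
      y • (gen k η : P ρ k j) ∈ ⨆ l, modGrading ρ k j l := by
    intro y η
    induction y using TensorProduct.induction_on with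
    | zero => rw [P_zero_smul]; exact zero_mem _
    | add y z hy hz => rw [P_add_smul]; exact add_mem hy hz
    | tmul a b =>
      obtain ⟨b, rfl⟩ := op_surjective b
      induction a using algGrading_induction with
      | h0 => rw [TensorProduct.zero_tmul, P_zero_smul]; exact zero_mem _
      | hadd a a' h h' => rw [TensorProduct.add_tmul, P_add_smul]; exact add_mem h h'
      | h α a ha =>
      induction b using algGrading_induction with
      | h0 => rw [op_zero, TensorProduct.tmul_zero, P_zero_smul]; exact zero_mem _
      | hadd a a' h h' => rw [op_add, TensorProduct.tmul_add, P_add_smul]; exact add_mem h h'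
      | h β b hb =>
      exact Submodule.mem_iSup_of_mem _ (tmul_smul_gen_mem_modGrading η ha hb rfl)
  induction hx using Submodule.span_induction with
  | mem x h =>
    obtain ⟨η, rfl⟩ := h
    have := key 1 η
    rwa [P_one_smul] at this
  | zero => exact zero_mem _
  | add x y _ _ hx hy => exact add_mem hx hy
  | smul a x hx h =>
    -- The sum of the graded parts is not yet known to be stable under the enveloping algebra, so
    -- `h` is of no use; a second induction runs with an arbitrary coefficient `a`.
    clear h
    induction hx using Submodule.span_induction generalizing a with
    | mem x h =>
      obtain ⟨η, rfl⟩ := h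
      exact key a η
    | zero => rw [P_smul_zero]; exact zero_mem _
    | add x y _ _ hx hy => rw [P_smul_add]; exact add_mem (hx a) (hy a)
    | smul b x _ hx => rw [P_smul_smul]; exact hx _

theorem tmul_smul_mem_modGrading {j : ℕ} {α l β : LamPlus ρ} {a b : ToricAlgebra ρ k}
    {x : P ρ k j} (ha : a ∈ algGrading ρ k α) (hx : x ∈ modGrading ρ k j l)
    (hb : b ∈ algGrading ρ k β) :
    (a ⊗ₜ[k] op b : Env ρ k) • x ∈ modGrading ρ k j (α + l + β) := by
  induction hx using Submodule.span_induction with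
  | mem x h =>
    obtain ⟨η, a', b', α', β', ha', hb', rfl, rfl⟩ := h
    rw [P_smul_smul, env_tmul_mul_tmul]
    exact tmul_smul_gen_mem_modGrading η (SetLike.GradedMul.mul_mem ha ha')
      (SetLike.GradedMul.mul_mem hb' hb) (by abel)
  | zero => rw [P_smul_zero]; exact zero_mem _
  | add x y _ _ hx hy => rw [P_smul_add]; exact add_mem hx hy
  | smul c x _ hx => rw [smul_comm]; exact Submodule.smul_mem _ _ hx

/-- The component of an element of `P_j` at a cell, as an element of the enveloping algebra. -/
def cellComponent {j : ℕ} (η : CellOfDim ρ j) : P ρ k j →ₗ[k] Env ρ k :=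
  ((summand k η.1).subtype ∘ₗ
    DirectSum.component (Env ρ k) (CellOfDim ρ j) (fun η => summand k η.1) η).restrictScalars k

theorem cellComponent_smul {j : ℕ} (η : CellOfDim ρ j) (y : Env ρ k) (x : P ρ k j) :
    cellComponent η (y • x) = y * cellComponent η x :=
  map_smul ((summand k η.1).subtype ∘ₗ
    DirectSum.component (Env ρ k) (CellOfDim ρ j) (fun η => summand k η.1) η) y x

theorem cellComponent_gen_self {j : ℕ} (η : CellOfDim ρ j) : cellComponent η (gen k η) =
    (vertexIdem k η.1.head ⊗ₜ[k] op (vertexIdem k η.1.tail) : Env ρ k) := by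
  change ((DirectSum.component (Env ρ k) (CellOfDim ρ j) (fun η => summand k η.1) η (gen k η) :
    summand k η.1) : Env ρ k) = _
  rw [gen, DirectSum.component.lof_self]

theorem cellComponent_gen_of_ne {j : ℕ} {η θ : CellOfDim ρ j} (h : θ ≠ η) :
    cellComponent η (gen k θ) = (0 : Env ρ k) := by
  change ((DirectSum.component (Env ρ k) (CellOfDim ρ j) (fun η => summand k η.1) η (gen k θ) :
    summand k η.1) : Env ρ k) = _
  rw [gen, DirectSum.component.of, dif_neg h]
  rfl

theorem ext_cellComponent {j : ℕ} (x y : P ρ k j)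
    (h : ∀ η, cellComponent η x = cellComponent η y) : x = y :=
  DFinsupp.ext fun η => Subtype.ext (h η)

/-- The linear map that records the total degrees of the homogeneous components of elements
`a ⊗ [η] ⊗ b`, where `δ` is the degree of `η`. -/
def envCoaction (hρ : ∏ i, ρ i = 1) (δ : LamPlus ρ) :
    Env ρ k →ₗ[k] (LamPlus ρ →₀ Env ρ k) :=
  Finsupp.lmapDomain (Env ρ k) k (fun l : LamPlus ρ × LamPlus ρ => l.1 + δ + l.2) ∘ₗ
    (finsuppTensorFinsupp k k (ToricAlgebra ρ k) (ToricAlgebra ρ k)ᵐᵒᵖ (LamPlus ρ)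
      (LamPlus ρ)).toLinearMap ∘ₗ
    TensorProduct.map (coactionFinsupp k hρ)
      (Finsupp.mapRange.linearMap (opLinearEquiv k).toLinearMap ∘ₗ coactionFinsupp k hρ ∘ₗ
        (opLinearEquiv k).symm.toLinearMap)

theorem envCoaction_tmul (hρ : ∏ i, ρ i = 1) (δ : LamPlus ρ) {α β : LamPlus ρ}
    {a b : ToricAlgebra ρ k} (ha : a ∈ algGrading ρ k α) (hb : b ∈ algGrading ρ k β) :
    envCoaction hρ δ (a ⊗ₜ[k] op b : Env ρ k) = Finsupp.single (α + δ + β) (a ⊗ₜ[k] op b) := by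
  have h2 : (Finsupp.mapRange.linearMap (opLinearEquiv k).toLinearMap ∘ₗ coactionFinsupp k hρ ∘ₗ
        (opLinearEquiv k).symm.toLinearMap) (op b) = Finsupp.single β (op b) := by
    change Finsupp.mapRange.linearMap (opLinearEquiv k).toLinearMap (coactionFinsupp k hρ b) = _
    rw [coactionFinsupp_of_mem k hρ hb, Finsupp.mapRange.linearMap_apply,
      Finsupp.mapRange_single]
    rfl
  change Finsupp.lmapDomain (Env ρ k) k (fun l : LamPlus ρ × LamPlus ρ => l.1 + δ + l.2)
    (finsuppTensorFinsupp k k (ToricAlgebra ρ k) (ToricAlgebra ρ k)ᵐᵒᵖ (LamPlus ρ) (LamPlus ρ)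
      (TensorProduct.map (coactionFinsupp k hρ) _ (a ⊗ₜ[k] op b))) = _
  rw [TensorProduct.map_tmul, h2, coactionFinsupp_of_mem k hρ ha, finsuppTensorFinsupp_single,
    Finsupp.lmapDomain_apply, Finsupp.mapDomain_single]

theorem vertexIdem_mem_algGrading (v : Vertex ρ) : vertexIdem k v ∈ algGrading ρ k 0 := by
  rw [← pathDeg_nil v]
  exact pathClass_mem_algGrading _

/-- The shift by the degree of `η` turns the degrees of the two tensor factors into the total
degree. The idempotents picked up from the generator have degree `0`, and generators of other cells
have no component at `η`. -/
theorem envCoaction_cellComponent (hρ : ∏ i, ρ i = 1) {j : ℕ} (η : CellOfDim ρ j)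
    {l : LamPlus ρ} {x : P ρ k j} (hx : x ∈ modGrading ρ k j l) :
    envCoaction hρ η.1.degree (cellComponent η x) = Finsupp.single l (cellComponent η x) := by
  induction hx using Submodule.span_induction with
  | mem x h =>
    obtain ⟨θ, a, b, α, β, ha, hb, rfl, rfl⟩ := h
    rw [cellComponent_smul]
    by_cases h : θ = η
    · subst h
      rw [cellComponent_gen_self, env_tmul_mul_tmul, envCoaction_tmul hρ _
        (SetLike.GradedMul.mul_mem ha (vertexIdem_mem_algGrading _))
        (SetLike.GradedMul.mul_mem (vertexIdem_mem_algGrading _) hb), add_zero, zero_add]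
    · rw [cellComponent_gen_of_ne h, mul_zero, map_zero, Finsupp.single_zero]
  | zero => rw [map_zero, map_zero, Finsupp.single_zero]
  | add x y _ _ hx hy => rw [map_add, map_add, hx, hy, Finsupp.single_add]
  | smul c x _ hx => rw [map_smul, map_smul, hx, Finsupp.smul_single]

variable (k) in
theorem isInternal_modGrading (hρ : ∏ i, ρ i = 1) (j : ℕ) :
    DirectSum.IsInternal (modGrading ρ k j) :=
  DirectSum.isInternal_of_linearMap_single _ (iSup_modGrading ρ k j)
    (fun η : CellOfDim ρ j => cellComponent η) ext_cellComponent
    (fun η => envCoaction hρ η.1.degree) fun η _ _ hx => envCoaction_cellComponent hρ η hx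

end Bimodule

/-! ## Paths over the covering quiver -/

/-- Divisors of lifted paths depend on their endpoints only; this makes the arbitrary choice in
`coverPath` harmless for classes and degrees. -/
theorem pathDiv_mapPath {u v : CoverVertex n} (p : Quiver.Path u v) (i : Fin n) :
    (pathDiv ((coverMap ρ).mapPath p) i : ℤ) = v.val i - u.val i := by
  induction p with
  | nil => simp
  | @cons v w p a ih =>
    have ha : w.val i = (v.val + Pi.single a.1 1 : Fin n → ℤ) i := congrFun a.2 i
    have e : pathDiv ((coverMap ρ).mapPath (p.cons a)) =
      pathDiv ((coverMap ρ).mapPath p) + Pi.single a.1 1 := rfl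
    rw [e, Pi.add_apply, Nat.cast_add, ih, ha, Pi.add_apply]
    by_cases h : i = a.1
    · subst h; simp; ring
    · simp [h]

theorem pathDiv_coverPath (u v : Fin n → ℤ) (h : u ≤ v) (i : Fin n) :
    (pathDiv (coverPath u v h : Quiver.Path (vertexOf ρ u) (vertexOf ρ v)) i : ℤ) = v i - u i :=
  pathDiv_mapPath _ i

theorem vertexOf_vadd {m : Fin n → ℤ} (hm : m ∈ lattice ρ) (u : Fin n → ℤ) :
    vertexOf ρ (m + u) = vertexOf ρ u := by
  have h : ∏ i, ρ i ^ m i = 1 := hm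
  change (∏ i, ρ i ^ (m i + u i))⁻¹ = (∏ i, ρ i ^ u i)⁻¹
  simp only [zpow_add, Finset.prod_mul_distrib, h, one_mul]

section Classes

variable (ρ) in
/-- The degree of a path over the covering quiver between two lattice points. -/
def coverDeg (u v : Fin n → ℤ) : LamPlus ρ :=
  if h : u ≤ v then pathDeg (coverPath u v h : Quiver.Path (vertexOf ρ u) (vertexOf ρ v)) else 0

theorem coverDeg_add (hρ : ∏ i, ρ i = 1) {u v w : Fin n → ℤ} (h : u ≤ v) (h' : v ≤ w) :
    coverDeg ρ u v + coverDeg ρ v w = coverDeg ρ u w := by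
  rw [coverDeg, coverDeg, coverDeg, dif_pos h, dif_pos h', dif_pos (h.trans h'), ← pathDeg_comp]
  refine pathDeg_eq hρ _ _ rfl rfl (funext fun i => ?_)
  zify
  rw [pathDiv_comp, Pi.add_apply, Nat.cast_add]
  simp only [pathDiv_coverPath]
  ring

theorem coverDeg_self (hρ : ∏ i, ρ i = 1) (u : Fin n → ℤ) : coverDeg ρ u u = 0 := by
  rw [coverDeg, dif_pos le_rfl, ← pathDeg_nil (vertexOf ρ u)]
  refine pathDeg_eq hρ _ _ rfl rfl (funext fun i => ?_)
  zify
  rw [pathDiv_coverPath]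
  simp

theorem coverDeg_vadd (hρ : ∏ i, ρ i = 1) {m : Fin n → ℤ} (hm : m ∈ lattice ρ)
    (u v : Fin n → ℤ) : coverDeg ρ (m + u) (m + v) = coverDeg ρ u v := by
  by_cases h : u ≤ v
  · rw [coverDeg, coverDeg, dif_pos h, dif_pos (add_le_add_right h m)]
    refine pathDeg_eq hρ _ _ (vertexOf_vadd hm u) (vertexOf_vadd hm v) (funext fun i => ?_)
    zify
    simp only [pathDiv_coverPath, Pi.add_apply]
    ring
  · rw [coverDeg, coverDeg, dif_neg h, dif_neg (by simpa using h)]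

variable (k : Type*) [Field k] [Finite X]

variable (ρ) in
/-- The class of a path over the covering quiver between two lattice points. -/
def coverClass (u v : Fin n → ℤ) : ToricAlgebra ρ k :=
  -- With the default value `0`, translation invariance, absorption of idempotents and homogeneity
  -- hold without assuming `u ≤ v`.
  if h : u ≤ v then
    pathClass k (coverPath u v h : Quiver.Path (vertexOf ρ u) (vertexOf ρ v)) else 0

/-- Both sides are classes of paths with divisor `w - u`. Multiplicativity of derivatives along
chains of faces comes from here. -/
theorem coverClass_mul {u v w : Fin n → ℤ} (h : u ≤ v) (h' : v ≤ w) :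
    coverClass ρ k v w * coverClass ρ k u v = coverClass ρ k u w := by
  rw [coverClass, coverClass, coverClass, dif_pos h, dif_pos h', dif_pos (h.trans h'),
    pathClass_mul]
  refine pathClass_eq k _ _ rfl rfl (funext fun i => ?_)
  zify
  rw [pathDiv_comp, Pi.add_apply, Nat.cast_add]
  simp only [pathDiv_coverPath]
  ring

theorem coverClass_vadd {m : Fin n → ℤ} (hm : m ∈ lattice ρ) (u v : Fin n → ℤ) :
    coverClass ρ k (m + u) (m + v) = coverClass ρ k u v := by
  by_cases h : u ≤ v
  · rw [coverClass, coverClass, dif_pos h, dif_pos (add_le_add_right h m)]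
    refine pathClass_eq k _ _ (vertexOf_vadd hm u) (vertexOf_vadd hm v) (funext fun i => ?_)
    zify
    simp only [pathDiv_coverPath, Pi.add_apply]
    ring
  · rw [coverClass, coverClass, dif_neg h, dif_neg (by simpa using h)]

theorem vertexIdem_mul_coverClass (u v : Fin n → ℤ) :
    vertexIdem k (vertexOf ρ v) * coverClass ρ k u v = coverClass ρ k u v := by
  rw [coverClass]
  split_ifs
  · rw [vertexIdem_mul_pathClass]
  · rw [mul_zero]

theorem coverClass_mul_vertexIdem (u v : Fin n → ℤ) :
    coverClass ρ k u v * vertexIdem k (vertexOf ρ u) = coverClass ρ k u v := by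
  rw [coverClass]
  split_ifs
  · rw [pathClass_mul_vertexIdem]
  · rw [zero_mul]

theorem coverClass_mem_algGrading (u v : Fin n → ℤ) :
    coverClass ρ k u v ∈ algGrading ρ k (coverDeg ρ u v) := by
  rw [coverClass, coverDeg]
  split_ifs
  · exact pathClass_mem_algGrading _
  · exact zero_mem _

end Classes

/-! ## Facets of faces of unit cubes -/

namespace CubeFace

/-- The facet of a face in the direction `p.1`, lower or upper according to `p.2`. -/
def side (F : CubeFace n) (p : Fin n × Bool) : CubeFace n :=
  ⟨if p.2 then F.base + Pi.single p.1 1 else F.base, F.dirs.erase p.1⟩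

/-- The indices of the facets of a face. -/
def sides (F : CubeFace n) : Finset (Fin n × Bool) := F.dirs ×ˢ Finset.univ

theorem mem_sides {F : CubeFace n} {p : Fin n × Bool} : p ∈ F.sides ↔ p.1 ∈ F.dirs := by
  simp [sides]

theorem side_mem_facets {F : CubeFace n} {p : Fin n × Bool} (hp : p ∈ F.sides) :
    F.side p ∈ F.facets := by
  rw [mem_facets_iff]
  refine ⟨p.1, mem_sides.mp hp, rfl, ?_⟩
  obtain ⟨i, _ | _⟩ := p
  · exact Or.inl rfl
  · exact Or.inr rfl

theorem side_isFacetOf {F : CubeFace n} {p : Fin n × Bool} (hp : p ∈ F.sides) :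
    Face.IsFacetOf (some (F.side p)) (some F) := (mem_facets _ _).mp (side_mem_facets hp)

theorem head_side_le {F : CubeFace n} {p : Fin n × Bool} (hp : p ∈ F.sides) :
    (F.side p).head ≤ F.head := head_le_of_isFaceOf (side_isFacetOf hp).1

theorem tail_le_side {F : CubeFace n} {p : Fin n × Bool} (hp : p ∈ F.sides) :
    F.tail ≤ (F.side p).tail := tail_le_of_isFaceOf (side_isFacetOf hp).1

theorem side_injOn (F : CubeFace n) : Set.InjOn F.side F.sides := by
  rintro ⟨i, s⟩ hi ⟨j, t⟩ hj h
  have hi : i ∈ F.dirs := mem_sides.mp hi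
  have hj : j ∈ F.dirs := mem_sides.mp hj
  have h1 : F.dirs.erase i = F.dirs.erase j := congrArg dirs h
  have hij : i = j := by
    by_contra hne
    have : i ∈ F.dirs.erase j := Finset.mem_erase.mpr ⟨hne, hi⟩
    rw [← h1] at this
    exact Finset.notMem_erase i _ this
  subst hij
  have h2 := congrFun (congrArg base h) i
  cases s <;> cases t <;> simp [side] at h2 ⊢

theorem facets_eq_image_side (F : CubeFace n) : F.facets = F.sides.image F.side := by
  ext F'
  rw [Finset.mem_image]
  constructor
  · intro h
    obtain ⟨i, hi, h1, h2 | h2⟩ := (mem_facets_iff F' F).mp h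
    · exact ⟨(i, false), mem_sides.mpr hi, CubeFace.ext h2.symm h1.symm⟩
    · exact ⟨(i, true), mem_sides.mpr hi, CubeFace.ext h2.symm h1.symm⟩
  · rintro ⟨p, hp, rfl⟩
    exact side_mem_facets hp

theorem sum_facets {M : Type*} [AddCommMonoid M] (F : CubeFace n) (f : CubeFace n → M) :
    ∑ F' ∈ F.facets, f F' = ∑ p ∈ F.sides, f (F.side p) := by
  rw [facets_eq_image_side, Finset.sum_image F.side_injOn]

/-- For distinct directions these are the two chains from a face to a codimension-two face;
exchanging them drives the cancellation in `d ∘ d` and the comparison of signs. -/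
theorem side_side_comm (F : CubeFace n) (p q : Fin n × Bool) :
    (F.side p).side q = (F.side q).side p := by
  obtain ⟨i, s⟩ := p
  obtain ⟨j, t⟩ := q
  refine CubeFace.ext ?_ Finset.erase_right_comm
  cases s <;> cases t <;> simp [side, add_right_comm]

theorem mem_sides_side {F : CubeFace n} {p q : Fin n × Bool} :
    q ∈ (F.side p).sides ↔ q.1 ≠ p.1 ∧ q ∈ F.sides := by
  rw [mem_sides, mem_sides, side, Finset.mem_erase]

theorem card_side {F : CubeFace n} {p : Fin n × Bool} (hp : p ∈ F.sides) {j : ℕ}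
    (h : F.dirs.card = j + 1) : (F.side p).dirs.card = j := by
  change (F.dirs.erase p.1).card = j
  rw [Finset.card_erase_of_mem (mem_sides.mp hp), h]
  rfl

theorem side_vadd (m : Fin n → ℤ) (F : CubeFace n) (p : Fin n × Bool) :
    (m +ᵥ F).side p = m +ᵥ F.side p := by
  obtain ⟨i, s⟩ := p
  refine CubeFace.ext ?_ rfl
  cases s
  · rfl
  · exact add_assoc _ _ _

theorem tail_vadd (m : Fin n → ℤ) (F : CubeFace n) : (m +ᵥ F).tail = m + F.tail := rfl

theorem head_vadd (m : Fin n → ℤ) (F : CubeFace n) : (m +ᵥ F).head = m + F.head :=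
  funext fun _ => add_assoc _ _ _

theorem head_eq_tail {F : CubeFace n} (h : F.dirs.card = 0) : F.head = F.tail := by
  rw [Finset.card_eq_zero] at h
  funext i
  simp [head, tail, h]

end CubeFace

/-! ### Independence of cell data from the chosen lift -/

theorem toCell_vadd {m : Fin n → ℤ} (hm : m ∈ lattice ρ) (F : CubeFace n) :
    toCell ρ (m +ᵥ F) = toCell ρ F := Quotient.sound ⟨⟨m, hm⟩, rfl⟩

/-- Any face is a translate of the chosen lift of its cell. -/
theorem exists_eq_vadd_lift (F : CubeFace n) :
    ∃ m ∈ lattice ρ, F = m +ᵥ (toCell ρ F).lift := by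
  obtain ⟨⟨m, hm⟩, e⟩ := Quotient.exact (Quotient.out_eq (toCell ρ F)).symm
  exact ⟨m, hm, e.symm⟩

theorem toCell_lift (η : Cell ρ) : toCell ρ η.lift = η := Quotient.out_eq η

/-- A facet of the chosen lift of a cell need not be the chosen lift of its own cell, so head, tail
and degree have to be computable from any lift. -/
theorem Cell.head_toCell (F : CubeFace n) : (toCell ρ F).head = vertexOf ρ F.head := by
  obtain ⟨m, hm, e⟩ := exists_eq_vadd_lift (ρ := ρ) F
  conv_rhs => rw [e, CubeFace.head_vadd, vertexOf_vadd hm]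
  rfl

theorem Cell.tail_toCell (F : CubeFace n) : (toCell ρ F).tail = vertexOf ρ F.tail := by
  obtain ⟨m, hm, e⟩ := exists_eq_vadd_lift (ρ := ρ) F
  conv_rhs => rw [e, CubeFace.tail_vadd, vertexOf_vadd hm]
  rfl

theorem Cell.degree_toCell (hρ : ∏ i, ρ i = 1) (F : CubeFace n) :
    (toCell ρ F).degree = coverDeg ρ F.tail F.head := by
  obtain ⟨m, hm, e⟩ := exists_eq_vadd_lift (ρ := ρ) F
  conv_rhs => rw [e, CubeFace.tail_vadd, CubeFace.head_vadd, coverDeg_vadd hρ hm, coverDeg,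
    dif_pos (CubeFace.tail_le_head _)]
  rfl

/-! ## The differential -/

theorem incidence_side_side (ε : IncidenceFunction ρ) {F : CubeFace n} {p q : Fin n × Bool}
    (hp : p ∈ F.sides) (hq : q ∈ F.sides) (hpq : p.1 ≠ q.1) :
    ε.toFun (some F) (some (F.side p)) * ε.toFun (some (F.side p)) (some ((F.side p).side q)) +
      ε.toFun (some F) (some (F.side q)) * ε.toFun (some (F.side q)) (some ((F.side q).side p))
      = 0 := by
  have h1 : q ∈ (F.side p).sides := CubeFace.mem_sides_side.mpr ⟨hpq.symm, hq⟩
  have h2 : p ∈ (F.side q).sides := CubeFace.mem_sides_side.mpr ⟨hpq, hp⟩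
  have e := CubeFace.side_side_comm F p q
  rw [← e]
  refine ε.sign _ _ _ _ ?_ (CubeFace.side_isFacetOf hp) (CubeFace.side_isFacetOf hq)
    (CubeFace.side_isFacetOf h1) ?_
  · intro h
    have := F.side_injOn hp hq (Option.some.inj h)
    exact hpq (congrArg Prod.fst this)
  · rw [e]
    exact CubeFace.side_isFacetOf h2

/-- The empty face has codimension two in an edge, and the sign rule applies to it with incidence
number `1` at both ends. -/
theorem sum_incidence_edge (ε : IncidenceFunction ρ) {F : CubeFace n} (h : F.dirs.card = 1) :
    ∑ p ∈ F.sides, ε.toFun (some F) (some (F.side p)) = 0 := by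
  obtain ⟨i, hi⟩ := Finset.card_eq_one.mp h
  have hp : ∀ s, (i, s) ∈ F.sides := fun s => CubeFace.mem_sides.mpr (by simp [hi])
  have hc : ∀ s, Face.dim (some (F.side (i, s))) = 0 := fun s => by
    have := CubeFace.card_side (hp s) (j := 0) h
    simp [Face.dim, this]
  have hn : ∀ s, Face.IsFacetOf none (some (F.side (i, s))) := fun s =>
    ⟨Set.empty_subset _, (hc s).symm ▸ rfl⟩
  have key := ε.sign (some F) none (some (F.side (i, true))) (some (F.side (i, false)))
    (fun h => by simpa using F.side_injOn (hp _) (hp _) (Option.some.inj h))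
    (CubeFace.side_isFacetOf (hp _)) (CubeFace.side_isFacetOf (hp _)) (hn _) (hn _)
  rw [ε.empty_face _ (hc _), ε.empty_face _ (hc _), mul_one, mul_one] at key
  rw [CubeFace.sides, hi, Finset.sum_product, Finset.sum_singleton, Fintype.sum_bool]
  exact key

section Differential

variable (k : Type*) [Field k] [Finite X]

attribute [local instance] instPAddCommMonoid instPModule instPModuleField instPAdd instPZero

/-- The product `(left derivative) ⊗ (right derivative)` of a face with respect to another. -/
def faceTerm (F F' : CubeFace n) : Env ρ k :=
  coverClass ρ k F'.head F.head ⊗ₜ[k] op (coverClass ρ k F.tail F'.tail)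

theorem faceTerm_mul {F F' F'' : CubeFace n} (h : F'.head ≤ F.head) (h' : F''.head ≤ F'.head)
    (ht : F.tail ≤ F'.tail) (ht' : F'.tail ≤ F''.tail) :
    (faceTerm k F F' * faceTerm k F' F'' : Env ρ k) = faceTerm k F F'' := by
  rw [faceTerm, faceTerm, env_tmul_mul_tmul, coverClass_mul k h' h, coverClass_mul k ht ht']
  rfl

theorem faceTerm_vadd {m : Fin n → ℤ} (hm : m ∈ lattice ρ) (F F' : CubeFace n) :
    (faceTerm k (m +ᵥ F) (m +ᵥ F') : Env ρ k) = faceTerm k F F' := by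
  simp only [faceTerm, CubeFace.tail_vadd, CubeFace.head_vadd, coverClass_vadd k hm]

theorem idem_mul_faceTerm (F F' : CubeFace n) :
    (vertexIdem k (vertexOf ρ F.head) ⊗ₜ[k] op (vertexIdem k (vertexOf ρ F.tail)) : Env ρ k) *
      faceTerm k F F' = faceTerm k F F' := by
  rw [faceTerm, env_tmul_mul_tmul, vertexIdem_mul_coverClass, coverClass_mul_vertexIdem]

/-- The generator `1 ⊗ [η] ⊗ 1` of the cell `η` below a face. -/
def faceGen (j : ℕ) (F : CubeFace n) : P ρ k j :=
  if h : F.dirs.card = j then gen k ⟨toCell ρ F, h⟩ else 0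

theorem faceGen_of_card {j : ℕ} {F : CubeFace n} (h : F.dirs.card = j) :
    (faceGen k j F : P ρ k j) = gen k ⟨toCell ρ F, h⟩ := dif_pos h

theorem faceGen_lift {j : ℕ} (η : CellOfDim ρ j) : faceGen k j η.1.lift = gen k η := by
  rw [faceGen_of_card k ((Cell.card_lift_dirs η.1).trans η.2)]
  congr 1
  exact Subtype.ext (toCell_lift η.1)

theorem faceGen_vadd {m : Fin n → ℤ} (hm : m ∈ lattice ρ) (j : ℕ) (F : CubeFace n) :
    (faceGen k j (m +ᵥ F) : P ρ k j) = faceGen k j F := by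
  by_cases h : F.dirs.card = j
  · rw [faceGen_of_card k h, faceGen_of_card k (F := m +ᵥ F) h]
    congr 1
    exact Subtype.ext (toCell_vadd hm F)
  · rw [faceGen, faceGen, dif_neg h, dif_neg (show ¬(m +ᵥ F).dirs.card = j from h)]

/-- The boundary of a face. -/
def faceBoundary (ε : IncidenceFunction ρ) (j : ℕ) (F : CubeFace n) : P ρ k j :=
  ∑ p ∈ F.sides, ((ε.toFun (some F) (some (F.side p)) : Env ρ k) * faceTerm k F (F.side p)) •
    (faceGen k j (F.side p) : P ρ k j)

/-- Incidence numbers, derivatives and generators are all invariant under `M`, so the differential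
of a cell may be computed on any lift, which is needed to iterate it. -/
theorem faceBoundary_vadd (ε : IncidenceFunction ρ) {m : Fin n → ℤ} (hm : m ∈ lattice ρ) (j : ℕ)
    (F : CubeFace n) : faceBoundary k ε j (m +ᵥ F) = faceBoundary k ε j F := by
  refine Finset.sum_congr rfl fun p _ => ?_
  have h := ε.invariant m hm (some F) (some (F.side p))
  rw [CubeFace.side_vadd, faceTerm_vadd k hm, faceGen_vadd k hm]
  congr 3

theorem boundary_eq_faceBoundary (ε : IncidenceFunction ρ) {j : ℕ} (η : CellOfDim ρ (j + 1)) :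
    boundary k ε η = faceBoundary k ε j η.1.lift := by
  have hη : η.1.lift.dirs.card = j + 1 := (Cell.card_lift_dirs η.1).trans η.2
  have h : boundary k ε η = ∑ F' : LiftFacet η,
      ((ε.toFun (some η.1.lift) (some F'.1) : Env ρ k) * faceTerm k η.1.lift F'.1) •
        (faceGen k j F'.1 : P ρ k j) := by
    refine Finset.sum_congr rfl fun F' _ => ?_
    rw [P_zsmul, P_smul_smul, faceGen_of_card k F'.cell.2, faceTerm, coverClass, coverClass,
      dif_pos (CubeFace.head_le_of_isFaceOf F'.isFaceOf),
      dif_pos (CubeFace.tail_le_of_isFaceOf F'.isFaceOf)]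
    rfl
  rw [h, faceBoundary, ← CubeFace.sum_facets η.1.lift fun F' =>
    ((ε.toFun (some η.1.lift) (some F') : Env ρ k) * faceTerm k η.1.lift F') •
        (faceGen k j F' : P ρ k j)]
  exact Finset.sum_coe_sort η.1.lift.facets fun F' =>
    ((ε.toFun (some η.1.lift) (some F') : Env ρ k) * faceTerm k η.1.lift F') •
        (faceGen k j F' : P ρ k j)

theorem P_smul_sum {j : ℕ} {ι : Type*} (s : Finset ι) (y : Env ρ k) (f : ι → P ρ k j) :
    y • ∑ i ∈ s, f i = ∑ i ∈ s, y • f i :=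
  map_sum (⟨⟨fun x => y • x, P_smul_zero k y⟩, P_smul_add k y⟩ : P ρ k j →+ P ρ k j) f s

/-- Left derivatives end at the head of `F` and right derivatives start at its tail. This is the
condition under which `ofGen` attains its prescribed value. -/
theorem idem_smul_faceBoundary (ε : IncidenceFunction ρ) (j : ℕ) (F : CubeFace n) :
    (vertexIdem k (vertexOf ρ F.head) ⊗ₜ[k] op (vertexIdem k (vertexOf ρ F.tail)) : Env ρ k) •
      faceBoundary k ε j F = faceBoundary k ε j F := by
  rw [faceBoundary, P_smul_sum]
  refine Finset.sum_congr rfl fun p _ => ?_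
  rw [P_smul_smul, ← mul_assoc, ← (Int.cast_commute _ _).eq, mul_assoc, idem_mul_faceTerm]

theorem diff_gen (ε : IncidenceFunction ρ) (j : ℕ) (η : CellOfDim ρ (j + 1)) :
    diff k ε j (gen k η) = boundary k ε η := by
  rw [diff, ofGen_gen, boundary_eq_faceBoundary]
  exact idem_smul_faceBoundary k ε j η.1.lift

theorem diff_faceGen (ε : IncidenceFunction ρ) (j : ℕ) {F : CubeFace n}
    (h : F.dirs.card = j + 1) : diff k ε j (faceGen k (j + 1) F) = faceBoundary k ε j F := by
  rw [faceGen_of_card k h, diff_gen, boundary_eq_faceBoundary]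
  obtain ⟨m, hm, e⟩ := exists_eq_vadd_lift (ρ := ρ) F
  conv_rhs => rw [e, faceBoundary_vadd k ε hm]

theorem diff_faceBoundary (ε : IncidenceFunction ρ) (j : ℕ) {F : CubeFace n}
    (hF : F.dirs.card = j + 1 + 1) : diff k ε j (faceBoundary k ε (j + 1) F) = 0 := by
  have h1 : diff k ε j (faceBoundary k ε (j + 1) F) = ∑ p ∈ F.sides, ∑ q ∈ (F.side p).sides,
      (((ε.toFun (some F) (some (F.side p)) *
        ε.toFun (some (F.side p)) (some ((F.side p).side q)) : ℤ) : Env ρ k) *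
          faceTerm k F ((F.side p).side q)) • (faceGen k j ((F.side p).side q) : P ρ k j) := by
    rw [faceBoundary, map_sum]
    refine Finset.sum_congr rfl fun p hp => ?_
    rw [map_smul, diff_faceGen k ε j (CubeFace.card_side hp hF), faceBoundary, P_smul_sum]
    refine Finset.sum_congr rfl fun q hq => ?_
    rw [P_smul_smul, ← faceTerm_mul k (CubeFace.head_side_le hp) (CubeFace.head_side_le hq)
      (CubeFace.tail_le_side hp) (CubeFace.tail_le_side hq), Int.cast_mul]
    congr 1
    rw [mul_assoc, mul_assoc, ← mul_assoc (faceTerm k F _), ← (Int.cast_commute _ _).eq, mul_assoc]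
  rw [h1, Finset.sum_sigma']
  -- Exchanging the order of the two steps gives the same codimension-two face and the same
  -- derivatives, with the opposite product of incidence numbers.
  refine Finset.sum_involution (fun x _ => ⟨x.2, x.1⟩) ?_ ?_ ?_ ?_
  · rintro ⟨p, q⟩ hx
    obtain ⟨hp, hq⟩ := Finset.mem_sigma.mp hx
    obtain ⟨hqp, hq⟩ := CubeFace.mem_sides_side.mp hq
    dsimp only
    rw [CubeFace.side_side_comm F q p, ← P_add_smul, ← add_mul, ← Int.cast_add]
    have := incidence_side_side ε hp hq hqp.symm
    rw [CubeFace.side_side_comm F q p] at this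
    rw [this, Int.cast_zero, zero_mul, P_zero_smul]
  · rintro ⟨p, q⟩ hx _ h
    obtain ⟨hp, hq⟩ := Finset.mem_sigma.mp hx
    obtain ⟨hqp, hq⟩ := CubeFace.mem_sides_side.mp hq
    exact hqp (congrArg (fun x => x.1.1) h)
  · rintro ⟨p, q⟩ hx
    obtain ⟨hp, hq⟩ := Finset.mem_sigma.mp hx
    obtain ⟨hqp, hq⟩ := CubeFace.mem_sides_side.mp hq
    exact Finset.mem_sigma.mpr ⟨hq, CubeFace.mem_sides_side.mpr ⟨hqp.symm, hp⟩⟩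
  · rintro ⟨p, q⟩ hx
    rfl

theorem diff_comp_diff (ε : IncidenceFunction ρ) (j : ℕ) :
    diff k ε j ∘ₗ diff k ε (j + 1) = 0 := by
  refine P_hom_ext fun η => ?_
  rw [LinearMap.comp_apply, diff_gen, boundary_eq_faceBoundary,
    diff_faceBoundary k ε j ((Cell.card_lift_dirs η.1).trans η.2), LinearMap.zero_apply]

theorem mult_faceGen {F : CubeFace n} (h : F.dirs.card = 0) :
    mult ρ k (faceGen k 0 F) = vertexIdem k (vertexOf ρ F.head) := by
  rw [faceGen_of_card k h, mult, ofGen_gen, env_tmul_smul, mul_one]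
  change vertexIdem k (toCell ρ F).head * vertexIdem k (toCell ρ F).tail = _
  rw [Cell.head_toCell, Cell.tail_toCell, ← CubeFace.head_eq_tail h, vertexIdem_mul_self]

theorem mult_gen (η : CellOfDim ρ 0) : mult ρ k (gen k η) = vertexIdem k η.1.head := by
  rw [← faceGen_lift, mult_faceGen k ((Cell.card_lift_dirs η.1).trans η.2)]
  rfl

theorem mult_faceBoundary (ε : IncidenceFunction ρ) {F : CubeFace n} (hF : F.dirs.card = 0 + 1) :
    mult ρ k (faceBoundary k ε 0 F) = 0 := by
  -- At a vertex head and tail coincide, so left times right derivative is the class of a path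
  -- across the whole edge, the same for both ends.
  have h1 : mult ρ k (faceBoundary k ε 0 F) = ∑ p ∈ F.sides,
      (ε.toFun (some F) (some (F.side p))) • coverClass ρ k F.tail F.head := by
    refine (map_sum (mult ρ k).toAddMonoidHom _ _).trans ?_
    refine Finset.sum_congr rfl fun p hp => ?_
    have hc := CubeFace.card_side hp hF
    have ht := CubeFace.tail_le_side hp
    change mult ρ k (_ • _) = _
    rw [map_smul, mult_faceGen k hc, mul_smul, faceTerm, env_tmul_smul,
      coverClass_mul_vertexIdem, ← CubeFace.head_eq_tail hc, coverClass_mul k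
        (by rw [CubeFace.head_eq_tail hc]; exact ht) (CubeFace.head_side_le hp),
      Int.cast_smul_eq_zsmul]
  rw [h1, ← Finset.sum_smul, sum_incidence_edge ε hF, zero_smul]

theorem mult_comp_diff (ε : IncidenceFunction ρ) : mult ρ k ∘ₗ diff k ε 0 = 0 := by
  refine P_hom_ext fun η => ?_
  rw [LinearMap.comp_apply, diff_gen, boundary_eq_faceBoundary,
    mult_faceBoundary k ε ((Cell.card_lift_dirs η.1).trans η.2), LinearMap.zero_apply]

theorem mult_mem_algGrading (hρ : ∏ i, ρ i = 1) {l : LamPlus ρ} {x : P ρ k 0}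
    (hx : x ∈ modGrading ρ k 0 l) : mult ρ k x ∈ algGrading ρ k l := by
  induction hx using Submodule.span_induction with
  | mem x h =>
    obtain ⟨η, a, b, α, β, ha, hb, rfl, rfl⟩ := h
    have hη : η.1.degree = 0 := by
      rw [← toCell_lift η.1, Cell.degree_toCell hρ,
        CubeFace.head_eq_tail ((Cell.card_lift_dirs η.1).trans η.2), coverDeg_self hρ]
    rw [map_smul, mult_gen, env_tmul_smul, hη]
    exact SetLike.GradedMul.mul_mem
      (SetLike.GradedMul.mul_mem ha (vertexIdem_mem_algGrading _)) hb
  | zero => rw [LinearMap.map_zero]; exact zero_mem _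
  | add x y _ _ hx hy => rw [map_add]; exact add_mem hx hy
  | smul c x _ hx =>
    rw [P_field_smul, map_smul]
    have : algebraMap k (Env ρ k) c • mult ρ k x = c • mult ρ k x := by
      rw [Algebra.TensorProduct.algebraMap_apply, ← op_one, env_tmul_smul, mul_one,
        Algebra.smul_def]
    rw [this]
    exact Submodule.smul_mem _ _ hx

theorem int_smul_mem_modGrading {j : ℕ} {l : LamPlus ρ} {x : P ρ k j}
    (hx : x ∈ modGrading ρ k j l) (z : ℤ) : (z : Env ρ k) • x ∈ modGrading ρ k j l := by
  have := Submodule.smul_mem _ (z : k) hx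
  rwa [P_field_smul, map_intCast] at this

theorem diff_mem_modGrading (hρ : ∏ i, ρ i = 1) (ε : IncidenceFunction ρ) {j : ℕ}
    {l : LamPlus ρ} {x : P ρ k (j + 1)} (hx : x ∈ modGrading ρ k (j + 1) l) :
    diff k ε j x ∈ modGrading ρ k j l := by
  induction hx using Submodule.span_induction with
  | mem x h =>
    obtain ⟨η, a, b, α, β, ha, hb, rfl, rfl⟩ := h
    have hη := (Cell.card_lift_dirs η.1).trans η.2
    rw [map_smul, diff_gen, boundary_eq_faceBoundary, faceBoundary, P_smul_sum]
    refine Submodule.sum_mem _ fun p hp => ?_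
    rw [P_smul_smul, ← mul_assoc, ← (Int.cast_commute _ _).eq, mul_assoc, ← P_smul_smul]
    refine int_smul_mem_modGrading k ?_ _
    rw [faceTerm, env_tmul_mul_tmul, faceGen_of_card k (CubeFace.card_side hp hη)]
    refine tmul_smul_gen_mem_modGrading _
      (SetLike.GradedMul.mul_mem ha (coverClass_mem_algGrading k _ _))
      (SetLike.GradedMul.mul_mem (coverClass_mem_algGrading k _ _) hb) ?_
    -- A path from tail to head can be routed through the facet: the right derivative, then a path
    -- in the facet, then the left derivative.
    have h2 : η.1.degree = coverDeg ρ η.1.lift.tail (η.1.lift.side p).tail +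
        (coverDeg ρ (η.1.lift.side p).tail (η.1.lift.side p).head +
          coverDeg ρ (η.1.lift.side p).head η.1.lift.head) := by
      rw [coverDeg_add hρ (CubeFace.tail_le_head _) (CubeFace.head_side_le hp),
        coverDeg_add hρ (CubeFace.tail_le_side hp)
          ((CubeFace.tail_le_head _).trans (CubeFace.head_side_le hp)),
        ← Cell.degree_toCell hρ, toCell_lift]
    rw [Cell.degree_toCell hρ, h2]
    abel
  | zero => rw [map_zero]; exact zero_mem _
  | add x y _ _ hx hy => rw [map_add]; exact add_mem hx hy
  | smul c x _ hx =>
    rw [P_field_smul, map_smul, ← P_field_smul]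
    exact Submodule.smul_mem _ _ hx

end Differential

/-! ## Comparison of incidence functions -/

namespace IncidenceFunction

/-- The sign of an incidence number. -/
def sgn (ε : IncidenceFunction ρ) (F F' : CubeFace n) : ℤˣ :=
  -- Values in `ℤˣ` make every sign its own inverse; for pairs that are not a face and a facet the
  -- value `1` is a mere default.
  if ε.toFun (some F) (some F') = -1 then -1 else 1

theorem coe_sgn (ε : IncidenceFunction ρ) {F : CubeFace n} {p : Fin n × Bool}
    (hp : p ∈ F.sides) : ((ε.sgn F (F.side p) : ℤˣ) : ℤ) = ε.toFun (some F) (some (F.side p)) := by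
  have h0 := (ε.ne_zero_iff (some F) (some (F.side p))).mpr (CubeFace.side_isFacetOf hp)
  rcases ε.values (some F) (some (F.side p)) with h | h | h
  · exact absurd h h0
  · rw [sgn, h]; rfl
  · rw [sgn, h]; rfl

theorem sgn_vadd (ε : IncidenceFunction ρ) {m : Fin n → ℤ} (hm : m ∈ lattice ρ)
    (F F' : CubeFace n) : ε.sgn (m +ᵥ F) (m +ᵥ F') = ε.sgn F F' := by
  have h := ε.invariant m hm (some F) (some F')
  simp only [Face.translate, Option.map_some] at h
  rw [sgn, sgn, h]

theorem sgn_square (ε : IncidenceFunction ρ) {F : CubeFace n} {p q : Fin n × Bool}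
    (hp : p ∈ F.sides) (hq : q ∈ F.sides) (hpq : p.1 ≠ q.1) :
    ε.sgn F (F.side p) * ε.sgn (F.side p) ((F.side p).side q) =
      -(ε.sgn F (F.side q) * ε.sgn (F.side q) ((F.side q).side p)) := by
  have h1 : q ∈ (F.side p).sides := CubeFace.mem_sides_side.mpr ⟨hpq.symm, hq⟩
  have h2 : p ∈ (F.side q).sides := CubeFace.mem_sides_side.mpr ⟨hpq, hp⟩
  apply Units.ext
  push_cast
  rw [coe_sgn ε hp, coe_sgn ε hq, coe_sgn ε h1, coe_sgn ε h2]
  exact eq_neg_of_add_eq_zero_left (incidence_side_side ε hp hq hpq)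

theorem sgn_edge (ε : IncidenceFunction ρ) {F : CubeFace n} (h : F.dirs.card = 1) {i : Fin n}
    (hi : i ∈ F.dirs) : ε.sgn F (F.side (i, true)) = -ε.sgn F (F.side (i, false)) := by
  have hd : F.dirs = {i} := by
    obtain ⟨j, hj⟩ := Finset.card_eq_one.mp h
    rw [hj] at hi ⊢
    rw [Finset.mem_singleton.mp hi]
  have hp : ∀ s, (i, s) ∈ F.sides := fun s => CubeFace.mem_sides.mpr hi
  have key := sum_incidence_edge ε h
  rw [CubeFace.sides, hd, Finset.sum_product, Finset.sum_singleton, Fintype.sum_bool] at key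
  apply Units.ext
  push_cast
  rw [coe_sgn ε (hp _), coe_sgn ε (hp _)]
  exact eq_neg_of_add_eq_zero_left key

/-- The quotient of the incidence numbers of two incidence functions. -/
def ratio (ε ε' : IncidenceFunction ρ) (F F' : CubeFace n) : ℤˣ := ε.sgn F F' * ε'.sgn F F'

/-- The minus signs of the two incidence functions cancel: the quotient is a multiplicative cocycle
on diamonds of faces. -/
theorem ratio_square (ε ε' : IncidenceFunction ρ) {F : CubeFace n} {p q : Fin n × Bool}
    (hp : p ∈ F.sides) (hq : q ∈ F.sides) (hpq : p.1 ≠ q.1) :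
    ratio ε ε' F (F.side p) * ratio ε ε' (F.side p) ((F.side p).side q) =
      ratio ε ε' F (F.side q) * ratio ε ε' (F.side q) ((F.side q).side p) := by
  rw [ratio, ratio, mul_mul_mul_comm, sgn_square ε hp hq hpq, sgn_square ε' hp hq hpq, neg_mul_neg,
    mul_mul_mul_comm]
  rfl

theorem ratio_mul_ratio (ε ε' ε'' : IncidenceFunction ρ) (F F' : CubeFace n) :
    ratio ε ε' F F' * ratio ε' ε'' F F' = ratio ε ε'' F F' := by
  rw [ratio, ratio, ratio, mul_assoc, ← mul_assoc (ε'.sgn F F'), Int.units_mul_self, one_mul]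

/-- The sign of a face which relates two incidence functions: the product of their quotients along
the chain of the lower facets in the smallest directions. -/
def faceSign (ε ε' : IncidenceFunction ρ) (F : CubeFace n) : ℤˣ :=
  ∏ i ∈ F.dirs, ratio ε ε' ⟨F.base, F.dirs.filter (i ≤ ·)⟩ ⟨F.base, F.dirs.filter (i < ·)⟩

theorem faceSign_of_card_eq_zero (ε ε' : IncidenceFunction ρ) {F : CubeFace n}
    (h : F.dirs.card = 0) : faceSign ε ε' F = 1 := by
  rw [faceSign, Finset.card_eq_zero.mp h, Finset.prod_empty]

theorem faceSign_self (ε : IncidenceFunction ρ) (F : CubeFace n) : faceSign ε ε F = 1 :=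
  Finset.prod_eq_one fun _ _ => Int.units_mul_self _

theorem faceSign_mul_faceSign (ε ε' ε'' : IncidenceFunction ρ) (F : CubeFace n) :
    faceSign ε ε' F * faceSign ε' ε'' F = faceSign ε ε'' F := by
  rw [faceSign, faceSign, faceSign, ← Finset.prod_mul_distrib]
  exact Finset.prod_congr rfl fun i _ => ratio_mul_ratio ε ε' ε'' _ _

theorem faceSign_vadd (ε ε' : IncidenceFunction ρ) {m : Fin n → ℤ} (hm : m ∈ lattice ρ)
    (F : CubeFace n) : faceSign ε ε' (m +ᵥ F) = faceSign ε ε' F :=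
  Finset.prod_congr rfl fun i _ =>
    congrArg₂ (· * ·) (sgn_vadd ε hm ⟨F.base, F.dirs.filter (i ≤ ·)⟩
      ⟨F.base, F.dirs.filter (i < ·)⟩)
      (sgn_vadd ε' hm ⟨F.base, F.dirs.filter (i ≤ ·)⟩
      ⟨F.base, F.dirs.filter (i < ·)⟩)

/-- Passing to the lower facet in the smallest direction cuts off the first link of the defining
chain. -/
theorem faceSign_min (ε ε' : IncidenceFunction ρ) {F : CubeFace n} {i : Fin n} (hi : i ∈ F.dirs)
    (hmin : ∀ j ∈ F.dirs, i ≤ j) : faceSign ε ε' F =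
      ratio ε ε' F (F.side (i, false)) * faceSign ε ε' (F.side (i, false)) := by
  rw [faceSign, ← Finset.mul_prod_erase _ _ hi, Finset.filter_true_of_mem hmin]
  have h1 : F.dirs.filter (i < ·) = F.dirs.erase i := by
    ext j
    rw [Finset.mem_filter, Finset.mem_erase]
    exact ⟨fun h => ⟨h.2.ne', h.1⟩, fun h => ⟨h.2, lt_of_le_of_ne (hmin j h.2) h.1.symm⟩⟩
  rw [h1]
  congr 1
  refine Finset.prod_congr rfl fun j hj => ?_
  have hij : i < j := lt_of_le_of_ne (hmin j (Finset.mem_of_mem_erase hj))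
    (Finset.ne_of_mem_erase hj).symm
  congr 2
  · change _ = (F.dirs.erase i).filter (j ≤ ·)
    rw [Finset.filter_erase, Finset.erase_eq_of_notMem]
    simp [hij]
  · change _ = (F.dirs.erase i).filter (j < ·)
    rw [Finset.filter_erase, Finset.erase_eq_of_notMem]
    simp [hij.le]

/-- The signs of a face and of its facets differ by the quotient of the incidence numbers. -/
theorem faceSign_eq (ε ε' : IncidenceFunction ρ) (N : ℕ) : ∀ (F : CubeFace n),
    F.dirs.card = N → ∀ p ∈ F.sides,
      faceSign ε ε' F = ratio ε ε' F (F.side p) * faceSign ε ε' (F.side p) := by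
  induction N with
  | zero =>
    intro F hF p hp
    rw [Finset.card_eq_zero] at hF
    have := CubeFace.mem_sides.mp hp
    simp [hF] at this
  | succ N ih =>
    intro F hF p hp
    -- By induction the sign of either facet is computed through their common facet, and
    -- `ratio_square` compares the two chains. So the formula spreads from one facet to every facet
    -- in another direction.
    have hpass : ∀ p q, p ∈ F.sides → q ∈ F.sides → p.1 ≠ q.1 →
        faceSign ε ε' F = ratio ε ε' F (F.side p) * faceSign ε ε' (F.side p) →
        faceSign ε ε' F = ratio ε ε' F (F.side q) * faceSign ε ε' (F.side q) := by
      intro p q hp hq hpq h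
      rw [h, ih _ (CubeFace.card_side hp hF) q (CubeFace.mem_sides_side.mpr ⟨hpq.symm, hq⟩),
        ih _ (CubeFace.card_side hq hF) p (CubeFace.mem_sides_side.mpr ⟨hpq, hp⟩),
        ← mul_assoc, ← mul_assoc, ratio_square ε ε' hp hq hpq, CubeFace.side_side_comm]
    obtain ⟨i, hi, hmin⟩ : ∃ i ∈ F.dirs, ∀ j ∈ F.dirs, i ≤ j := by
      have hne : F.dirs.Nonempty := Finset.card_pos.mp (by omega)
      exact ⟨F.dirs.min' hne, Finset.min'_mem _ hne, fun j hj => Finset.min'_le _ j hj⟩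
    have hi' : ∀ s, (i, s) ∈ F.sides := fun s => CubeFace.mem_sides.mpr hi
    have h0 := faceSign_min ε ε' hi hmin
    by_cases hpi : p.1 = i
    · obtain ⟨j, s⟩ := p
      obtain rfl : j = i := hpi
      cases s
      · exact h0
      -- The opposite facet in the smallest direction shares no facet with the known one. It is
      -- reached through a facet in a second direction `l`. An edge has no such direction, but there
      -- both incidence functions change sign between the two ends, so the quotients agree.
      · by_cases hN : N = 0
        · subst hN
          rw [h0, faceSign_of_card_eq_zero ε ε' (CubeFace.card_side (hi' _) hF),
            faceSign_of_card_eq_zero ε ε' (CubeFace.card_side hp hF), ratio, ratio,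
            sgn_edge ε hF hi, sgn_edge ε' hF hi, neg_mul_neg]
        · obtain ⟨l, hl, hlj⟩ := Finset.exists_mem_ne (s := F.dirs) (by omega) j
          have hl' : (l, false) ∈ F.sides := CubeFace.mem_sides.mpr hl
          exact hpass _ _ hl' hp hlj (hpass _ _ (hi' false) hl' hlj.symm h0)
    · exact hpass _ _ (hi' false) hp (Ne.symm hpi) h0

/-- The coefficientwise form of the statement that the sign maps commute with the differentials. -/
theorem toFun_mul_faceSign (ε ε' : IncidenceFunction ρ) {F : CubeFace n} {p : Fin n × Bool}
    (hp : p ∈ F.sides) :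
    ε.toFun (some F) (some (F.side p)) * ((faceSign ε ε' (F.side p) : ℤˣ) : ℤ) =
      ((faceSign ε ε' F : ℤˣ) : ℤ) * ε'.toFun (some F) (some (F.side p)) := by
  rw [← coe_sgn ε hp, ← coe_sgn ε' hp, ← Units.val_mul, ← Units.val_mul,
    faceSign_eq ε ε' _ F rfl p hp, ratio, mul_right_comm, mul_assoc (ε.sgn F _) (ε'.sgn F _),
    Int.units_mul_self, mul_one]

/-- The sign of a cell which relates two incidence functions. -/
def cellSign (ε ε' : IncidenceFunction ρ) (η : Cell ρ) : ℤˣ := faceSign ε ε' η.lift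

theorem cellSign_toCell (ε ε' : IncidenceFunction ρ) (F : CubeFace n) :
    cellSign ε ε' (toCell ρ F) = faceSign ε ε' F := by
  obtain ⟨m, hm, e⟩ := exists_eq_vadd_lift (ρ := ρ) F
  conv_rhs => rw [e, faceSign_vadd ε ε' hm]
  rfl

end IncidenceFunction

section Comparison

open IncidenceFunction

variable (k : Type*) [Field k] [Finite X]

attribute [local instance] instPAddCommMonoid instPModule instPModuleField instPAdd instPZero

/-- The bimodule homomorphism which multiplies the generators by the signs that relate two
incidence functions. -/
def signMap (ε ε' : IncidenceFunction ρ) (j : ℕ) : P ρ k j →ₗ[Env ρ k] P ρ k j :=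
  ofGen k fun η => (((cellSign ε ε' η.1 : ℤˣ) : ℤ) : Env ρ k) • gen k η

theorem signMap_gen (ε ε' : IncidenceFunction ρ) {j : ℕ} (η : CellOfDim ρ j) :
    signMap k ε ε' j (gen k η) = (((cellSign ε ε' η.1 : ℤˣ) : ℤ) : Env ρ k) • gen k η := by
  rw [signMap, ofGen_gen, P_smul_smul, ← (Int.cast_commute _ _).eq, ← P_smul_smul, idem_smul_gen]

theorem signMap_self (ε : IncidenceFunction ρ) (j : ℕ) :
    signMap k ε ε j = LinearMap.id := by
  refine P_hom_ext fun η => ?_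
  rw [signMap_gen, cellSign, faceSign_self, Units.val_one, Int.cast_one, P_one_smul,
    LinearMap.id_apply]

theorem signMap_comp (ε ε' ε'' : IncidenceFunction ρ) (j : ℕ) :
    signMap k ε' ε'' j ∘ₗ signMap k ε ε' j = signMap k ε ε'' j := by
  refine P_hom_ext fun η => ?_
  rw [LinearMap.comp_apply, signMap_gen, map_smul, signMap_gen, signMap_gen, P_smul_smul,
    ← Int.cast_mul, ← Units.val_mul]
  congr 4
  exact faceSign_mul_faceSign ε ε' ε'' _

/-- The isomorphism of bimodules which relates the complexes of two incidence functions. -/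
def signEquiv (ε ε' : IncidenceFunction ρ) (j : ℕ) : P ρ k j ≃ₗ[Env ρ k] P ρ k j :=
  LinearEquiv.ofLinearMap (signMap k ε ε' j) (signMap k ε' ε j)
    (by rw [signMap_comp, signMap_self]) (by rw [signMap_comp, signMap_self])

theorem signMap_faceGen (ε ε' : IncidenceFunction ρ) {j : ℕ} {F : CubeFace n}
    (h : F.dirs.card = j) : signMap k ε ε' j (faceGen k j F) =
      (((faceSign ε ε' F : ℤˣ) : ℤ) : Env ρ k) • (faceGen k j F : P ρ k j) := by
  rw [faceGen_of_card k h, signMap_gen, cellSign_toCell]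

theorem signMap_comp_diff (ε ε' : IncidenceFunction ρ) (j : ℕ) :
    signMap k ε ε' j ∘ₗ diff k ε j = diff k ε' j ∘ₗ signMap k ε ε' (j + 1) := by
  refine P_hom_ext fun η => ?_
  have hη := (Cell.card_lift_dirs η.1).trans η.2
  rw [LinearMap.comp_apply, LinearMap.comp_apply, signMap_gen, map_smul, diff_gen, diff_gen,
    boundary_eq_faceBoundary, boundary_eq_faceBoundary, faceBoundary, faceBoundary, P_smul_sum,
    map_sum]
  refine Finset.sum_congr rfl fun p hp => ?_
  rw [map_smul, signMap_faceGen k ε ε' (CubeFace.card_side hp hη), P_smul_smul, P_smul_smul,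
    ← mul_assoc, mul_assoc _ (faceTerm k _ _), ← (Int.cast_commute _ (faceTerm k _ _)).eq,
    ← mul_assoc, ← Int.cast_mul, ← Int.cast_mul, toFun_mul_faceSign ε ε' hp]
  rfl

/-- Vertices carry the sign `1`, an empty product, which is why the isomorphism can be the identity
on `A`. -/
theorem mult_comp_signMap (ε ε' : IncidenceFunction ρ) :
    mult ρ k ∘ₗ signMap k ε ε' 0 = mult ρ k := by
  refine P_hom_ext fun η => ?_
  rw [LinearMap.comp_apply, signMap_gen, cellSign,
    faceSign_of_card_eq_zero ε ε' ((Cell.card_lift_dirs η.1).trans η.2), Units.val_one,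
    Int.cast_one, P_one_smul]

theorem signMap_mem_modGrading (ε ε' : IncidenceFunction ρ) {j : ℕ} {l : LamPlus ρ}
    {x : P ρ k j} (hx : x ∈ modGrading ρ k j l) : signMap k ε ε' j x ∈ modGrading ρ k j l := by
  induction hx using Submodule.span_induction with
  | mem x h =>
    obtain ⟨η, a, b, α, β, ha, hb, rfl, rfl⟩ := h
    rw [map_smul, signMap_gen, P_smul_smul, ← (Int.cast_commute _ _).eq, ← P_smul_smul]
    exact int_smul_mem_modGrading k (tmul_smul_gen_mem_modGrading η ha hb rfl) _
  | zero => rw [map_zero]; exact zero_mem _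
  | add x y _ _ hx hy => rw [map_add]; exact add_mem hx hy
  | smul c x _ hx =>
    rw [P_field_smul, map_smul, ← P_field_smul]
    exact Submodule.smul_mem _ _ hx

theorem signEquiv_signEquiv (ε ε' ε'' : IncidenceFunction ρ) (j : ℕ) (x : P ρ k j) :
    signEquiv k ε' ε'' j (signEquiv k ε ε' j x) = signEquiv k ε ε'' j x :=
  LinearMap.congr_fun (signMap_comp k ε ε' ε'' j) x

theorem signEquiv_self (ε : IncidenceFunction ρ) (j : ℕ) (x : P ρ k j) :
    signEquiv k ε ε j x = x :=
  LinearMap.congr_fun (signMap_self k ε j) x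

theorem signEquiv_mem_modGrading_iff (ε ε' : IncidenceFunction ρ) {j : ℕ} {l : LamPlus ρ}
    {x : P ρ k j} : signEquiv k ε ε' j x ∈ modGrading ρ k j l ↔ x ∈ modGrading ρ k j l := by
  refine ⟨fun h => ?_, signMap_mem_modGrading k ε ε'⟩
  have := signMap_mem_modGrading k ε' ε h
  rwa [show signMap k ε' ε j (signEquiv k ε ε' j x) = x from
    (signEquiv_signEquiv k ε ε' ε j x).trans (signEquiv_self k ε j x)] at this

end Comparison

end McKay

/-! ### The determinant condition, vanishing above dimension `n`, and the proposition -/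

namespace McKay

/-- The diagonal entries of a matrix in `SL(n)` have product `1`. -/
theorem prod_diagChar {k : Type*} [Field k] {n : ℕ}
    (G : Subgroup (Matrix.SpecialLinearGroup (Fin n) k))
    (hG : ∀ g ∈ G, (g : Matrix (Fin n) (Fin n) k).IsDiag) : ∏ i, diagChar G hG i = 1 := by
  refine MonoidHom.ext fun g => Units.ext ?_
  rw [MonoidHom.finsetProd_apply, Units.coe_prod, MonoidHom.one_apply, Units.val_one,
    ← Matrix.SpecialLinearGroup.det_coe g.1, ← (hG g.1 g.2).diagonal_diag, Matrix.det_diagonal]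
  rfl

theorem subsingleton_P {n : ℕ} {X : Type*} [CommGroup X] (ρ : Fin n → X) (k : Type*) [Field k]
    [Finite X] {j : ℕ} (h : n < j) : Subsingleton (P ρ k j) := by
  have : IsEmpty (CellOfDim ρ j) := ⟨fun η => by
    have h1 : η.1.lift.dirs.card = j := (Cell.card_lift_dirs η.1).trans η.2
    have h2 := Finset.card_le_univ η.1.lift.dirs
    rw [Fintype.card_fin] at h2
    omega⟩
  exact ⟨fun x y => DFinsupp.ext fun η => isEmptyElim η⟩

end McKay

end

theorem mainTheorem11 {k : Type*} [Field k] [IsAlgClosed k] (n : ℕ)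
    (G : Subgroup (Matrix.SpecialLinearGroup (Fin n) k)) [Finite G]
    (hchar : (Nat.card G : k) ≠ 0)
    (hdiag : ∀ g ∈ G, (g : Matrix (Fin n) (Fin n) k).IsDiag)
    (ρ : Fin n → (G →* kˣ)) (hρ : ρ = McKay.diagChar G hdiag) :
    -- `A` is a `Λ₊`-graded algebra
    (SetLike.GradedMonoid (McKay.algGrading ρ k) ∧
      DirectSum.IsInternal (McKay.algGrading ρ k)) ∧
    -- every `P_j` is a `Λ₊`-graded `(A,A)`-bimodule, and it vanishes for `j > n`
    (∀ j : ℕ, DirectSum.IsInternal (McKay.modGrading ρ k j) ∧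
      ∀ (α l β : McKay.LamPlus ρ) (a b : McKay.ToricAlgebra ρ k) (x : McKay.P ρ k j),
        a ∈ McKay.algGrading ρ k α → x ∈ McKay.modGrading ρ k j l →
        b ∈ McKay.algGrading ρ k β →
          (a ⊗ₜ[k] MulOpposite.op b : McKay.Env ρ k) • x
            ∈ McKay.modGrading ρ k j (α + l + β)) ∧
    (∀ j : ℕ, n < j → Subsingleton (McKay.P ρ k j)) ∧
    -- `μ` is the multiplication map, and it preserves degrees
    (∀ η : McKay.CellOfDim ρ 0,
      McKay.mult ρ k (McKay.gen k η) = McKay.vertexIdem k η.1.head) ∧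
    (∀ (l : McKay.LamPlus ρ) (x : McKay.P ρ k 0), x ∈ McKay.modGrading ρ k 0 l →
      McKay.mult ρ k x ∈ McKay.algGrading ρ k l) ∧
    -- for every incidence function, the maps `d_j` are given by the stated formula, preserve
    -- degrees and, together with `μ`, form a complex
    (∀ ε : McKay.IncidenceFunction ρ,
      (∀ (j : ℕ) (η : McKay.CellOfDim ρ (j + 1)),
        McKay.diff k ε j (McKay.gen k η) = McKay.boundary k ε η) ∧
      (∀ (j : ℕ) (l : McKay.LamPlus ρ) (x : McKay.P ρ k (j + 1)),
        x ∈ McKay.modGrading ρ k (j + 1) l →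
          McKay.diff k ε j x ∈ McKay.modGrading ρ k j l) ∧
      (∀ j : ℕ, McKay.diff k ε j ∘ₗ McKay.diff k ε (j + 1) = 0) ∧
      McKay.mult ρ k ∘ₗ McKay.diff k ε 0 = 0) ∧
    -- the complexes of different incidence functions are naturally isomorphic: there is a
    -- coherent family of isomorphisms of complexes of graded bimodules over `A`, each of which
    -- multiplies every generator by a sign
    (∃ Φ : (ε ε' : McKay.IncidenceFunction ρ) → (j : ℕ) →
        (McKay.P ρ k j ≃ₗ[McKay.Env ρ k] McKay.P ρ k j),
      (∀ ε ε' : McKay.IncidenceFunction ρ,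
        (∃ δ : McKay.Cell ρ → ℤˣ, ∀ (j : ℕ) (η : McKay.CellOfDim ρ j),
          Φ ε ε' j (McKay.gen k η) = ((δ η.1 : ℤˣ) : ℤ) • McKay.gen k η) ∧
        (∀ (j : ℕ) (x : McKay.P ρ k (j + 1)),
          Φ ε ε' j (McKay.diff k ε j x) = McKay.diff k ε' j (Φ ε ε' (j + 1) x)) ∧
        (∀ x : McKay.P ρ k 0, McKay.mult ρ k (Φ ε ε' 0 x) = McKay.mult ρ k x) ∧
        (∀ (j : ℕ) (l : McKay.LamPlus ρ) (x : McKay.P ρ k j),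
          Φ ε ε' j x ∈ McKay.modGrading ρ k j l ↔ x ∈ McKay.modGrading ρ k j l)) ∧
      (∀ (ε : McKay.IncidenceFunction ρ) (j : ℕ) (x : McKay.P ρ k j), Φ ε ε j x = x) ∧
      (∀ (ε ε' ε'' : McKay.IncidenceFunction ρ) (j : ℕ) (x : McKay.P ρ k j),
        Φ ε' ε'' j (Φ ε ε' j x) = Φ ε ε'' j x)) := by
  -- The determinant condition enters only here, and serves only the statements about degrees.
  have hprod : ∏ i, ρ i = 1 := by rw [hρ, McKay.prod_diagChar]
  refine ⟨⟨inferInstance, McKay.isInternal_algGrading k hprod⟩,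
    fun j => ⟨McKay.isInternal_modGrading k hprod j,
      fun α l β a b x ha hx hb => McKay.tmul_smul_mem_modGrading ha hx hb⟩,
    fun j hj => McKay.subsingleton_P ρ k hj, McKay.mult_gen k,
    fun l x hx => McKay.mult_mem_algGrading k hprod hx,
    fun ε => ⟨McKay.diff_gen k ε, fun j l x hx => McKay.diff_mem_modGrading k hprod ε hx,
      McKay.diff_comp_diff k ε, McKay.mult_comp_diff k ε⟩,
    McKay.signEquiv k, fun ε ε' => ⟨⟨McKay.IncidenceFunction.cellSign ε ε', fun j η => ?_⟩,
      fun j x => LinearMap.congr_fun (McKay.signMap_comp_diff k ε ε' j) x,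
      fun x => LinearMap.congr_fun (McKay.mult_comp_signMap k ε ε') x,
      fun j l x => McKay.signEquiv_mem_modGrading_iff k ε ε'⟩,
    McKay.signEquiv_self k, McKay.signEquiv_signEquiv k⟩
  rw [McKay.P_zsmul]
  exact McKay.signMap_gen k ε ε' η
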